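/- Let $D\subset\mathbb R^d$, $d\ge 1$, be a bounded open set (for instance a bounded Lipschitz domain with $d\in\{1,2,3\}$), let $V=H^1_0(D)$ be the closure of $C_c^\infty(D)$ in $H^1(D)$, normed by $\|v\|_V=\|\nabla v\|_{L^2(D)}$, and let $f\in V^*$. Let $\psi_j\in L^\infty(D)$, $j\in\mathbb N$, be such that there is a sequence of positive numbers $(\lambda_j)$ with $\sum_j \exp(-\lambda_j^2)<\infty$ for which $\sum_j\lambda_j|\psi_j|$ converges in $L^\infty(D)$. Let $\gamma$ be the countable product on $U=\mathbb R^{\mathbb N}$ of the standard Gaussian measure on $\mathbb R$. For $y\in U$ put $b(y)=\sum_j y_j\psi_j$ (convergence a.e. in $D$), let $U_0$ be the set of those $y$ for which $b(y)$ exists and belongs to $L^\infty(D)$, and for $y\in U_0$ let $u(y)\in V$ be the weak solution of $-\operatorname{div}(\exp(b(y))\nabla u(y))=f$ in $D$, $u(y)=0$ on $\partial D$, that is $$\int_D \exp(b(y))\,\nabla u(y)\cdot\nabla v\,dx=\langle f,v\rangle\qquad\text{for all } v\in V .$$ Let $\mathcal F$ be the set of finitely supported sequences $\nu=(\nu_j)_{j\in\mathbb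 N}$ of nonnegative integers; write $\nu!=\prod_j\nu_j!$ and $c^{\nu}=\prod_j c_j^{\nu_j}$. Let $H_k(x)=\frac{(-1)^k}{\sqrt{k!}}e^{x^2/2}\frac{d^k}{dx^k}e^{-x^2/2}$, $H_\nu(y)=\prod_jH_{\nu_j}(y_j)$, $u_\nu=\int_U u(y)H_\nu(y)\,d\gamma(y)\in V$, and $$\beta_\nu(r,\varrho)=\prod_{j}\sum_{\ell=0}^{r}\binom{\nu_j}{\ell}\varrho_j^{2\ell}.$$ Let $0<q<\infty$, let $\varrho=(\varrho_j)$ be a sequence of positive numbers with $(\varrho_j^{-1})\in\ell^q(\mathbb N)$, and let $r\in\mathbb N$ with $r>2/q$. Assume that for each $\nu\in\mathcal F$ there is a sequence $\rho_\nu=(\rho_{\nu,j})_j$ of nonnegative numbers with $\rho_{\nu,j}\neq0$ whenever $\nu_j\neq 0$, such that $$\sup_{\nu\in\mathcal F}\Big\|\sum_j\rho_{\nu,j}|\psi_j|\Big\|_{L^\infty(D)}\le\kappa<\frac{\pi}{2}\qquad\text{and}\qquad \sum_{\nu\in\mathcal F,\ \|\nu\|_{\ell^\infty}\le r}\frac{\nu!\,\varrho^{2\nu}}{\rho_\nu^{2\nu}}<\infty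 .$$ Then $\gamma$-almost every $y$ belongs to $U_0$, the weak solution $u(y)$ exists and is unique for every $y\in U_0$, $u\in L^2(U,V;\gamma)$ (so that the $u_\nu$ are well defined), $$\sum_{\nu\in\mathcal F}\beta_\nu(r,\varrho)\,\|u_\nu\|_V^2<\infty\qquad\text{and}\qquad \big(\beta_\nu(r,\varrho)^{-1/2}\big)_{\nu\in\mathcal F}\in\ell^q(\mathcal F),$$ and $(\|u_\nu\|_V)_{\nu\in\mathcal F}\in\ell^p(\mathcal F)$, where $\frac1p=\frac1q+\frac12$. -/

import Mathlib

open MeasureTheory ProbabilityTheory Filter Topology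
open scoped ENNReal ContDiff Nat Gradient

noncomputable section

namespace LogGaussian

/-- `ℝ^d` with the Euclidean norm. -/
abbrev Space (d : ℕ) : Type := EuclideanSpace ℝ (Fin d)

/-- `L^∞(D)`, real valued. -/
abbrev LInf {d : ℕ} (D : Set (Space d)) : Type := Lp ℝ ∞ (volume.restrict D)

/-- Pairs `(v, g)` in `L²(D) × L²(D; ℝ^d)` with the norm `(‖v‖² + ‖g‖²)^{1/2}`. For `g = ∇ v`
this is the norm of `H¹(D)`. -/
abbrev L2Pair {d : ℕ} (D : Set (Space d)) : Type :=
  WithLp 2 (Lp ℝ 2 (volume.restrict D) × Lp (Space d) 2 (volume.restrict D))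

/-- The pairs `(η, ∇ η)` with `η ∈ C_c^∞(D)`. -/
def testPairs {d : ℕ} (D : Set (Space d)) : Submodule ℝ (L2Pair D) where
  carrier := {p | ∃ η : Space d → ℝ, ContDiff ℝ ∞ η ∧ HasCompactSupport η ∧ tsupport η ⊆ D ∧
    (p.fst =ᵐ[volume.restrict D] η) ∧ (p.snd =ᵐ[volume.restrict D] ∇ η)}
  zero_mem' := by
    refine ⟨fun _ => 0, contDiff_const, HasCompactSupport.zero, ?_, ?_, ?_⟩
    · simp [tsupport]
    · exact Lp.coeFn_zero _ _ _
    · refine (Lp.coeFn_zero (Space d) 2 (volume.restrict D)).trans ?_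
      refine Eventually.of_forall fun x => ?_
      simp [gradient]
  add_mem' := by
    rintro p q ⟨η, hη, cη, sη, h1, h2⟩ ⟨θ, hθ, cθ, sθ, k1, k2⟩
    refine ⟨η + θ, hη.add hθ, cη.add cθ, (tsupport_add η θ).trans (Set.union_subset sη sθ), ?_, ?_⟩
    · exact (Lp.coeFn_add p.fst q.fst).trans (h1.add k1)
    · refine (Lp.coeFn_add p.snd q.snd).trans ((h2.add k2).trans ?_)
      refine Eventually.of_forall fun x => ?_
      have e := fderiv_add (𝕜 := ℝ) ((hη.differentiable (by simp)) x)
        ((hθ.differentiable (by simp)) x)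
      simp only [gradient, Pi.add_apply, e, map_add]
  smul_mem' := by
    rintro c p ⟨η, hη, cη, sη, h1, h2⟩
    refine ⟨c • η, hη.const_smul c, cη.smul_left (f := fun _ => c), ?_, ?_, ?_⟩
    · exact (closure_mono (Function.support_const_smul_subset c η)).trans sη
    · exact (Lp.coeFn_smul c p.fst).trans (h1.const_smul c)
    · refine (Lp.coeFn_smul c p.snd).trans ((h2.const_smul c).trans ?_)
      refine Eventually.of_forall fun x => ?_
      have e := fderiv_const_smul (𝕜 := ℝ) ((hη.differentiable (by simp)) x) c
      simp only [gradient, Pi.smul_apply, e, map_smul]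

/-- `V = H¹₀(D)`, the closure of `C_c^∞(D)` in the norm of `H¹(D)`; an element `v` is stored
together with its weak gradient, as the pair `(v, ∇ v)`. -/
abbrev H10 {d : ℕ} (D : Set (Space d)) : Submodule ℝ (L2Pair D) :=
  (testPairs D).topologicalClosure

/-- The weak gradient of `v ∈ H¹₀(D)`. -/
def grad {d : ℕ} {D : Set (Space d)} (v : H10 D) : Lp (Space d) 2 (volume.restrict D) :=
  (v : L2Pair D).snd

/-- The norm `‖v‖_V = ‖∇ v‖_{L²(D)}`. -/
def normV {d : ℕ} {D : Set (Space d)} (v : H10 D) : ℝ := ‖grad v‖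

/-- `u` is the weak solution of `-div (exp(b) ∇ u) = f` in `D`, `u = 0` on `∂D`. -/
def IsWeakSolution {d : ℕ} {D : Set (Space d)} (b : LInf D) (f : H10 D →L[ℝ] ℝ)
    (u : H10 D) : Prop :=
  ∀ v : H10 D, ∫ x in D, Real.exp (b x) * inner ℝ (grad u x) (grad v x) = f v

/-- `b = b(y)`: the series `∑_j y_j ψ_j` converges almost everywhere in `D` to `b ∈ L^∞(D)`. -/
def IsLogCoeff {d : ℕ} {D : Set (Space d)} (ψ : ℕ → LInf D) (y : ℕ → ℝ) (b : LInf D) : Prop :=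
  ∀ᵐ x ∂(volume.restrict D),
    Tendsto (fun n => ∑ j ∈ Finset.range n, y j * ψ j x) atTop (𝓝 (b x))

/-- The set `U₀` of the parameters `y` with `b(y) ∈ L^∞(D)`. -/
def U0 {d : ℕ} {D : Set (Space d)} (ψ : ℕ → LInf D) : Set (ℕ → ℝ) :=
  {y | ∃ b : LInf D, IsLogCoeff ψ y b}

open Classical in
/-- The parametric solution `y ↦ u(y) ∈ H¹₀(D)`, with the value `0` outside of `U₀`. -/
def solution {d : ℕ} {D : Set (Space d)} (ψ : ℕ → LInf D) (f : H10 D →L[ℝ] ℝ)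
    (y : ℕ → ℝ) : H10 D :=
  if h : ∃ u : H10 D, ∃ b : LInf D, IsLogCoeff ψ y b ∧ IsWeakSolution b f u then h.choose else 0

/-- The standing assumption on the functions `ψ_j`: there are `λ_j > 0` such that
`(exp(-λ_j²)) ∈ ℓ¹` and `∑_j λ_j |ψ_j|` converges in `L^∞(D)`. -/
def SeriesAssumption {d : ℕ} {D : Set (Space d)} (ψ : ℕ → LInf D) : Prop :=
  ∃ lam : ℕ → ℝ, (∀ j, 0 < lam j) ∧ Summable (fun j => Real.exp (-(lam j) ^ 2)) ∧
    ∃ S : LInf D, Tendsto (fun n => ∑ j ∈ Finset.range n, lam j • |ψ j|) atTop (𝓝 S)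

/-- The standard Gaussian measure on `ℝ^ℕ`. -/
def gaussian : Measure (ℕ → ℝ) := Measure.infinitePi fun _ : ℕ => gaussianReal 0 1

/-- The normalized probabilistic Hermite polynomial `H_k`. -/
def hermiteN (k : ℕ) (x : ℝ) : ℝ :=
  Polynomial.aeval x (Polynomial.hermite k) / √(k ! : ℝ)

/-- `H_ν(y) = ∏_j H_{ν_j}(y_j)`; the factors with `ν_j = 0` are `1`. -/
def hermiteMulti (ν : ℕ →₀ ℕ) (y : ℕ → ℝ) : ℝ := ν.prod fun j k => hermiteN k (y j)

/-- The Wiener-Hermite coefficient `u_ν = ∫ u(y) H_ν(y) dγ(y)`. -/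
def hermiteCoeff {X : Type*} [NormedAddCommGroup X] [NormedSpace ℝ X] (u : (ℕ → ℝ) → X)
    (ν : ℕ →₀ ℕ) : X :=
  ∫ y, hermiteMulti ν y • u y ∂gaussian

/-- `ν! = ∏_j ν_j!`. -/
def multiFactorial (ν : ℕ →₀ ℕ) : ℝ := ν.prod fun _ k => (k ! : ℝ)

/-- `c^ν = ∏_j c_j^{ν_j}`. -/
def multiPow (c : ℕ → ℝ) (ν : ℕ →₀ ℕ) : ℝ := ν.prod fun j k => c j ^ k

/-- The weight `β_ν(r, ϱ) = ∏_j ∑_{l ≤ r} (ν_j choose l) ϱ_j^{2 l}`; the factors with `ν_j = 0`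
are `1`. -/
def beta (r : ℕ) (ϱ : ℕ → ℝ) (ν : ℕ →₀ ℕ) : ℝ :=
  ν.prod fun j k => ∑ l ∈ Finset.range (r + 1), (k.choose l : ℝ) * ϱ j ^ (2 * l)

end LogGaussian

end

noncomputable section

namespace LogGaussian

/-! ### The Gaussian measure on sequences and Hermite polynomials -/

/-! Gaussian integration by parts against Hermite polynomials turns a derivative into an index
shift: the α-th coefficient of the mixed derivative ∂^μ u has squared norm μ! binom(α+μ, μ)
‖u_{α+μ}‖² (`IsGaussianCoeff.norm_hermiteCoeff_mixedDeriv`). Bessel's inequality bounds the sum of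
these over α by ∫ ‖∂^μ u‖² dγ; only orthonormality of the Hermite system enters, not its
completeness.

The derivatives are bounded by complex analysis. For complex b in L^∞, Re exp(b) = exp(Re b) cos(Im
b), so the form stays coercive on the strip ‖Im b‖ < π/2, and the solution is holomorphic in b
there, with growth exp ‖Re b‖ (`isStripHolomorphic_solveOp`). Since κ < π/2, the polydisc about b(y)
with radii ρ_{μ,j} lies in the strip, and Cauchy's estimate gives ‖∂^μ u(y)‖ ≤ C (μ!/ρ_μ^μ) exp
‖b(y)‖. The assumption on the λ_j makes exp ‖b(y)‖ square integrable (`isGaussianCoeff_logCoeff`).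
Hence, with a constant Q independent of μ, ∑_α binom(α+μ, μ) ‖u_{α+μ}‖² ≤ Q μ!/ρ_μ^{2μ}
(`IsGaussianCoeff.sum_multiChoose_le`). Since β_ν is the sum of binom(ν, μ) ϱ^{2μ} over all μ
bounded by r, multiplying by ϱ^{2μ} and summing over μ gives the weighted square summability
(`summable_beta_mul`).

The ℓ^q claim is independent of the equation: the sum over ν factorises over j, and each factor is 1
+ O(ϱ_j^{-q}) because rq/2 > 1 (`memℓp_beta`). Hölder's inequality joins the two facts
(`memℓp_of_weighted`).

The complex analysis takes place in a closed complex space of gradient fields, whose norm restricts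
to ‖·‖_V on real gradients; `cgrad_eq_solveOp` identifies the real solution there. -/

instance isProbabilityMeasure_gaussian : IsProbabilityMeasure gaussian := by
  unfold gaussian; infer_instance

/-- Resampling the coordinate `j` preserves the Gaussian measure. -/
lemma measurePreserving_update (j : ℕ) :
    MeasurePreserving (fun p : ℝ × (ℕ → ℝ) => Function.update p.2 j p.1)
      ((gaussianReal 0 1).prod gaussian) gaussian := by
  have hmeas : Measurable (fun p : ℝ × (ℕ → ℝ) => Function.update p.2 j p.1) := by
    refine measurable_pi_iff.2 fun i => ?_
    by_cases h : i = j
    · subst h; simpa using measurable_fst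
    · simp only [Function.update_of_ne h]
      exact (measurable_pi_apply i).comp measurable_snd
  refine ⟨hmeas, ?_⟩
  refine Measure.eq_infinitePi (μ := fun _ : ℕ => gaussianReal 0 1) fun s t ht => ?_
  rw [Measure.map_apply hmeas (MeasurableSet.pi s.countable_toSet fun i _ => ht i)]
  -- The preimage of a box is again a box: the constraint on coordinate j moves to the fresh
  -- variable and the old coordinate j becomes free.
  have hpre : (fun p : ℝ × (ℕ → ℝ) => Function.update p.2 j p.1) ⁻¹' (Set.pi (s : Set ℕ) t) =
      (if j ∈ s then t j else Set.univ) ×ˢ Set.pi ((s.erase j : Finset ℕ) : Set ℕ) t := by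
    ext ⟨x, y⟩
    simp only [Set.mem_preimage, Set.mem_pi, Set.mem_prod, Finset.mem_coe, Finset.mem_erase]
    constructor
    · intro h
      refine ⟨?_, fun i hi => by simpa [hi.1] using h i hi.2⟩
      split_ifs with hj
      · simpa using h j hj
      · trivial
    · rintro ⟨h1, h2⟩ i hi
      by_cases hij : i = j
      · subst hij; simpa [hi] using h1
      · simpa [hij] using h2 i ⟨hij, hi⟩
  rw [hpre, Measure.prod_prod]
  unfold gaussian
  rw [Measure.infinitePi_pi _ (fun i _ => ht i)]
  split_ifs with hj
  · exact Finset.mul_prod_erase s (fun i => gaussianReal 0 1 (t i)) hj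
  · simp [Finset.erase_eq_of_notMem hj]

/-! ### Hermite polynomials: derivatives, integration by parts, orthonormality -/

lemma hermiteN_zero (x : ℝ) : hermiteN 0 x = 1 := by simp [hermiteN]

lemma derivative_hermite_succ (n : ℕ) :
    Polynomial.derivative (Polynomial.hermite (n + 1)) =
      ((n + 1 : ℕ) : Polynomial ℤ) * Polynomial.hermite n := by
  induction n with
  | zero => simp
  | succ n ih =>
    rw [Polynomial.hermite_succ (n + 1), Polynomial.derivative_sub, Polynomial.derivative_mul, ih,
      Polynomial.derivative_X, Polynomial.derivative_mul, Polynomial.derivative_natCast,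
      Polynomial.hermite_succ n]
    push_cast
    ring

lemma hasDerivAt_hermiteN_succ (k : ℕ) (x : ℝ) :
    HasDerivAt (hermiteN (k + 1)) (√((k : ℝ) + 1) * hermiteN k x) x := by
  have h := ((Polynomial.hermite (k + 1)).hasDerivAt_aeval x).div_const √((k + 1)! : ℝ)
  refine h.congr_deriv ?_
  rw [derivative_hermite_succ]
  simp only [hermiteN, map_mul, map_natCast]
  have hk : (0 : ℝ) < (k : ℝ) + 1 := by positivity
  have hf : (0 : ℝ) < √(k ! : ℝ) := Real.sqrt_pos.2 (by positivity)
  have hs : (0 : ℝ) < √((k : ℝ) + 1) := Real.sqrt_pos.2 hk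
  rw [Nat.factorial_succ, Nat.cast_mul, Real.sqrt_mul (by positivity)]
  push_cast
  field_simp
  rw [Real.sq_sqrt hk.le]
  ring

lemma hasDerivAt_gaussianPDFReal (t : ℝ) :
    HasDerivAt (gaussianPDFReal 0 1) (-t * gaussianPDFReal 0 1 t) t := by
  have h : HasDerivAt (fun x : ℝ => -(x - 0) ^ 2 / (2 * ((1 : NNReal) : ℝ))) (-t) t := by
    have := ((((hasDerivAt_id t).sub_const 0).pow 2).neg).div_const (2 * ((1 : NNReal) : ℝ))
    refine this.congr_deriv ?_
    simp
    ring
  have h2 := (h.exp).const_mul ((√(2 * Real.pi * ((1 : NNReal) : ℝ)))⁻¹)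
  rw [gaussianPDFReal_def]
  refine h2.congr_deriv ?_
  simp only
  ring

/-- The recursion He_{k+1} = x He_k - He_k' says that differentiating density times polynomial
raises the degree; √(k+1) comes from the normalization. -/
lemma hasDerivAt_pdf_mul_hermiteN (k : ℕ) (t : ℝ) :
    HasDerivAt (fun t => gaussianPDFReal 0 1 t * hermiteN k t)
      (-(√((k : ℝ) + 1) * (gaussianPDFReal 0 1 t * hermiteN (k + 1) t))) t := by
  have h := (hasDerivAt_gaussianPDFReal t).mul
    (((Polynomial.hermite k).hasDerivAt_aeval t).div_const √(k ! : ℝ))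
  refine h.congr_deriv ?_
  have hk : (0 : ℝ) < (k : ℝ) + 1 := by positivity
  have hf : (0 : ℝ) < √(k ! : ℝ) := Real.sqrt_pos.2 (by positivity)
  have hs : (0 : ℝ) < √((k : ℝ) + 1) := Real.sqrt_pos.2 hk
  simp only [hermiteN]
  rw [Nat.factorial_succ, Nat.cast_mul, Real.sqrt_mul (by positivity), Polynomial.hermite_succ]
  push_cast
  simp only [map_sub, map_mul, Polynomial.aeval_X]
  field_simp
  ring

lemma continuous_hermiteN (k : ℕ) : Continuous (hermiteN k) :=
  ((Polynomial.hermite k).continuous_aeval).div_const _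

lemma integrable_pdf_smul_iff {X : Type*} [NormedAddCommGroup X] [NormedSpace ℝ X] {f : ℝ → X} :
    Integrable (fun x => gaussianPDFReal 0 1 x • f x) ↔ Integrable f (gaussianReal 0 1) := by
  rw [gaussianReal_of_var_ne_zero _ one_ne_zero,
    integrable_withDensity_iff_integrable_smul' (measurable_gaussianPDF 0 1)
      (ae_of_all _ fun _ => gaussianPDF_lt_top)]
  simp only [toReal_gaussianPDF]

/-- Gaussian integration by parts against a Hermite polynomial. -/
lemma integral_hermiteN_smul_deriv {X : Type*} [NormedAddCommGroup X] [NormedSpace ℝ X]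
    {g g' : ℝ → X} (h : ∀ t, HasDerivAt g (g' t) t) (k : ℕ) (c : ℝ)
    (h1 : Integrable (fun t => (hermiteN k t * c) • g' t) (gaussianReal 0 1))
    (h2 : Integrable (fun t => (hermiteN (k + 1) t * c) • g t) (gaussianReal 0 1))
    (h3 : Integrable (fun t => (hermiteN k t * c) • g t) (gaussianReal 0 1)) :
    ∫ t, (hermiteN k t * c) • g' t ∂(gaussianReal 0 1) =
      √((k : ℝ) + 1) • ∫ t, (hermiteN (k + 1) t * c) • g t ∂(gaussianReal 0 1) := by
  rw [integral_gaussianReal_eq_integral_smul one_ne_zero,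
    integral_gaussianReal_eq_integral_smul one_ne_zero]
  rw [← integrable_pdf_smul_iff] at h1 h2 h3
  have hv : ∀ t : ℝ, HasDerivAt (fun t => gaussianPDFReal 0 1 t * hermiteN k t * c)
      (-(√((k : ℝ) + 1) * (gaussianPDFReal 0 1 t * hermiteN (k + 1) t)) * c) t :=
    fun t => (hasDerivAt_pdf_mul_hermiteN k t).mul_const c
  have key := integral_bilinear_hasDerivAt_right_eq_neg_left_of_integrable
    (L := ContinuousLinearMap.lsmul ℝ ℝ (E := X))
    (u := fun t => gaussianPDFReal 0 1 t * hermiteN k t * c)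
    (u' := fun t => -(√((k : ℝ) + 1) * (gaussianPDFReal 0 1 t * hermiteN (k + 1) t)) * c)
    (v := g) (v' := g') (fun t _ => hv t) (fun t _ => h t)
    (by simpa [smul_smul, mul_assoc] using h1)
    (by
      have := h2.smul (-√((k : ℝ) + 1))
      refine this.congr (ae_of_all _ fun t => ?_)
      simp only [Pi.smul_apply, smul_smul, ContinuousLinearMap.lsmul_apply]
      congr 1; ring)
    (by simpa [smul_smul, mul_assoc] using h3)
  simp only [ContinuousLinearMap.lsmul_apply] at key
  rw [← integral_smul, ← integral_neg] at *
  refine Eq.trans (integral_congr_ae (ae_of_all _ fun t => ?_))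
    (key.trans (integral_congr_ae (ae_of_all _ fun t => ?_)))
  · simp only [smul_smul]; congr 1; ring
  · simp only [smul_smul, ← neg_smul]; congr 1; ring

lemma integrable_aeval_gaussianReal (p : Polynomial ℝ) :
    Integrable (fun x => Polynomial.eval x p) (gaussianReal 0 1) := by
  simp only [Polynomial.eval_eq_sum_range]
  refine integrable_finsetSum _ fun i _ => Integrable.const_mul ?_ _
  have h : MemLp (id : ℝ → ℝ) i (gaussianReal 0 1) :=
    memLp_id_gaussianReal' (i : ℝ≥0∞) (ENNReal.natCast_ne_top i)
  have h2 := h.integrable_norm_pow'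
  refine h2.mono' (by fun_prop) (ae_of_all _ fun x => by simp)

lemma integrable_hermiteN_mul (k l : ℕ) :
    Integrable (fun x => hermiteN k x * hermiteN l x) (gaussianReal 0 1) := by
  have h := integrable_aeval_gaussianReal
    ((Polynomial.hermite k).map (Int.castRingHom ℝ) * (Polynomial.hermite l).map (Int.castRingHom ℝ))
  refine (h.const_mul ((√(k ! : ℝ))⁻¹ * (√(l ! : ℝ))⁻¹)).congr (ae_of_all _ fun x => ?_)
  simp only [hermiteN, Polynomial.eval_mul, Polynomial.aeval_def, Polynomial.eval_map,
    algebraMap_int_eq]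
  ring

/-- Integration by parts lowers both indices by one, until one of them is 0 and the derivative of a
constant appears. -/
lemma integral_hermiteN_mul (k l : ℕ) :
    ∫ x, hermiteN k x * hermiteN l x ∂(gaussianReal 0 1) = if k = l then 1 else 0 := by
  have hrec : ∀ k l : ℕ, ∫ x, hermiteN (k + 1) x * hermiteN l x ∂(gaussianReal 0 1) =
      (√((k : ℝ) + 1))⁻¹ * ∫ x, hermiteN k x * deriv (hermiteN l) x ∂(gaussianReal 0 1) := by
    intro k l
    have hs : (0 : ℝ) < √((k : ℝ) + 1) := Real.sqrt_pos.2 (by positivity)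
    have hd : ∀ t, HasDerivAt (hermiteN l) (deriv (hermiteN l) t) t := fun t =>
      (((Polynomial.hermite l).hasDerivAt_aeval t).div_const √(l ! : ℝ)).differentiableAt.hasDerivAt
    have := integral_hermiteN_smul_deriv hd k 1 ?_ ?_ ?_
    · simp only [smul_eq_mul, mul_one] at this
      rw [this]; field_simp
    · simp only [smul_eq_mul, mul_one]
      cases l with
      | zero =>
        have : deriv (hermiteN 0) = fun _ => 0 := by
          have h0 : hermiteN 0 = fun _ => 1 := funext hermiteN_zero
          rw [h0]; simp
        simp [this]
      | succ l =>
        simp only [fun t => (hasDerivAt_hermiteN_succ l t).deriv]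
        refine ((integrable_hermiteN_mul k l).const_mul √((l : ℝ) + 1)).congr
          (ae_of_all _ fun x => ?_)
        simp only; ring
    · simpa using integrable_hermiteN_mul (k + 1) l
    · simpa using integrable_hermiteN_mul k l
  have h0 : hermiteN 0 = fun _ => 1 := funext hermiteN_zero
  have hz : ∀ k : ℕ, ∫ x, hermiteN (k + 1) x * hermiteN 0 x ∂(gaussianReal 0 1) = 0 := by
    intro k
    rw [hrec, h0]; simp
  induction k generalizing l with
  | zero =>
    cases l with
    | zero => simp [h0]
    | succ l => simpa [mul_comm] using hz l
  | succ k ih =>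
    cases l with
    | zero => simpa using hz k
    | succ l =>
      rw [hrec]
      simp only [fun t => (hasDerivAt_hermiteN_succ l t).deriv]
      have : ∀ x, hermiteN k x * (√((l : ℝ) + 1) * hermiteN l x) =
        √((l : ℝ) + 1) * (hermiteN k x * hermiteN l x) := fun x => by ring
      simp only [this, integral_const_mul, ih]
      by_cases hkl : k = l
      · subst hkl
        have hs : √((k : ℝ) + 1) ≠ 0 := (Real.sqrt_pos.2 (by positivity)).ne'
        simp [hs]
      · simp [hkl]

lemma hermiteMulti_update (α : ℕ →₀ ℕ) (j : ℕ) (y : ℕ → ℝ) (t : ℝ) :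
    hermiteMulti α (Function.update y j t) =
      hermiteN (α j) t * hermiteMulti (α.erase j) y := by
  unfold hermiteMulti
  rw [← Finsupp.mul_prod_erase' α j _ (fun i => hermiteN_zero _)]
  simp only [Function.update_self]
  congr 1
  refine Finset.prod_congr rfl fun i hi => ?_
  have : i ≠ j := by
    rintro rfl; simp at hi
  simp [this]

lemma hermiteMulti_eq_prod {s : Finset ℕ} {ν : ℕ →₀ ℕ} (hs : ν.support ⊆ s) (y : ℕ → ℝ) :
    hermiteMulti ν y = ∏ i ∈ s, hermiteN (ν i) (y i) :=
  Finsupp.prod_of_support_subset _ hs _ fun _ _ => hermiteN_zero _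

/-- A cylinder function only sees the marginal on `s`, a finite product measure, where Fubini
applies. -/
lemma integrable_prod_gaussian (s : Finset ℕ) (g : ℕ → ℝ → ℝ)
    (hg : ∀ i, Integrable (g i) (gaussianReal 0 1)) :
    Integrable (fun y : ℕ → ℝ => ∏ i ∈ s, g i (y i)) gaussian ∧
      ∫ y, ∏ i ∈ s, g i (y i) ∂gaussian = ∏ i ∈ s, ∫ t, g i t ∂(gaussianReal 0 1) := by
  have hmap := Measure.infinitePi_map_restrict (μ := fun _ : ℕ => gaussianReal 0 1) (I := s)
  have hint : Integrable (fun z : s → ℝ => ∏ i : s, g i (z i))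
      (Measure.pi fun _ : s => gaussianReal 0 1) :=
    Integrable.fintype_prod (f := fun i : s => g i) fun i => hg i
  have heq : ∀ y : ℕ → ℝ, ∏ i ∈ s, g i (y i) = ∏ i : s, g i (s.restrict y i) := fun y =>
    (Finset.prod_coe_sort s fun i => g i (y i)).symm
  constructor
  · simp only [heq]
    have hmp : MeasurePreserving s.restrict gaussian (Measure.pi fun _ : s => gaussianReal 0 1) :=
      ⟨Finset.measurable_restrict s, hmap⟩
    exact (hmp.integrable_comp hint.aestronglyMeasurable).2 hint
  · simp only [heq]
    unfold gaussian
    rw [integral_restrict_infinitePi (X := fun _ : ℕ => ℝ) (s := s)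
      (f := fun z : s → ℝ => ∏ i : s, g i (z i)) (fun _ => gaussianReal 0 1)
      hint.aestronglyMeasurable,
      integral_fintype_prod_eq_prod (fun i : s => g i)]
    exact Finset.prod_coe_sort s fun i => ∫ t, g i t ∂(gaussianReal 0 1)

lemma integrable_hermiteMulti_mul (ν μ : ℕ →₀ ℕ) :
    Integrable (fun y => hermiteMulti ν y * hermiteMulti μ y) gaussian ∧
      ∫ y, hermiteMulti ν y * hermiteMulti μ y ∂gaussian = if ν = μ then 1 else 0 := by
  have hs1 : ν.support ⊆ ν.support ∪ μ.support := Finset.subset_union_left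
  have hs2 : μ.support ⊆ ν.support ∪ μ.support := Finset.subset_union_right
  simp only [hermiteMulti_eq_prod hs1, hermiteMulti_eq_prod hs2, ← Finset.prod_mul_distrib]
  have h := integrable_prod_gaussian (ν.support ∪ μ.support)
    (fun i t => hermiteN (ν i) t * hermiteN (μ i) t) fun i => integrable_hermiteN_mul _ _
  refine ⟨h.1, h.2.trans ?_⟩
  simp only [integral_hermiteN_mul]
  split_ifs with hνμ
  · subst hνμ; simp
  · obtain ⟨i, hi⟩ : ∃ i, ν i ≠ μ i := by
      by_contra hcon
      push Not at hcon
      exact hνμ (Finsupp.ext hcon)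
    refine Finset.prod_eq_zero (i := i) ?_ (by simp [hi])
    simp only [Finset.mem_union, Finsupp.mem_support_iff]
    by_contra hcon
    push Not at hcon
    exact hi (hcon.1.trans hcon.2.symm)

lemma measurable_hermiteMulti (ν : ℕ →₀ ℕ) : Measurable (hermiteMulti ν) := by
  unfold hermiteMulti Finsupp.prod
  exact Finset.measurable_prod _ fun i _ =>
    (continuous_hermiteN _).measurable.comp (measurable_pi_apply i)

lemma memLp_hermiteMulti (ν : ℕ →₀ ℕ) : MemLp (hermiteMulti ν) 2 gaussian := by
  rw [memLp_two_iff_integrable_sq (measurable_hermiteMulti ν).aestronglyMeasurable]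
  simpa [sq] using (integrable_hermiteMulti_mul ν ν).1

lemma integrable_hermiteMulti_smul {X : Type*} [NormedAddCommGroup X] [NormedSpace ℝ X]
    {w : (ℕ → ℝ) → X} (hw : MemLp w 2 gaussian) (ν : ℕ →₀ ℕ) :
    Integrable (fun y => hermiteMulti ν y • w y) gaussian :=
  memLp_one_iff_integrable.1 (hw.smul (memLp_hermiteMulti ν) (r := 1))

/-- Differentiating in the coordinate `j` shifts the Hermite coefficients. -/
lemma hermiteCoeff_deriv {X : Type*} [NormedAddCommGroup X] [NormedSpace ℝ X]
    {w w' : (ℕ → ℝ) → X} (hw : MemLp w 2 gaussian) (hw' : MemLp w' 2 gaussian) (j : ℕ)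
    (hd : ∀ᵐ y ∂gaussian, ∀ t, HasDerivAt (fun t => w (Function.update y j t))
      (w' (Function.update y j t)) t) (α : ℕ →₀ ℕ) :
    hermiteCoeff w' α = √((α j : ℝ) + 1) • hermiteCoeff w (α + Finsupp.single j 1) := by
  have hmp := measurePreserving_update j
  have i1 := integrable_hermiteMulti_smul hw' α
  have i2 := integrable_hermiteMulti_smul hw (α + Finsupp.single j 1)
  have i3 := integrable_hermiteMulti_smul hw α
  have hint : ∀ F : (ℕ → ℝ) → X, Integrable F gaussian →
      Integrable (fun p : ℝ × (ℕ → ℝ) => F (Function.update p.2 j p.1))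
        ((gaussianReal 0 1).prod gaussian) ∧
      ∫ y, F y ∂gaussian = ∫ y, ∫ t, F (Function.update y j t) ∂(gaussianReal 0 1) ∂gaussian := by
    -- Resampling coordinate j isolates a one-dimensional Gaussian integral in t for almost every
    -- frozen y.
    intro F hF
    have h1 := (hmp.integrable_comp hF.aestronglyMeasurable).2 hF
    refine ⟨h1, ?_⟩
    rw [← hmp.map_eq, integral_map hmp.measurable.aemeasurable
      (by rw [hmp.map_eq]; exact hF.aestronglyMeasurable), hmp.map_eq]
    exact integral_prod_symm _ h1
  unfold hermiteCoeff
  rw [(hint _ i1).2, (hint _ i2).2, ← integral_smul]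
  refine integral_congr_ae ?_
  filter_upwards [hd, (hint _ i1).1.prod_left_ae, (hint _ i2).1.prod_left_ae,
    (hint _ i3).1.prod_left_ae] with y hy s1 s2 s3
  -- Raising the index at j leaves the other factors alone, so both integrals carry the same frozen
  -- constant.
  have herase : (α + Finsupp.single j 1).erase j = α.erase j := by
    ext i
    by_cases h : i = j
    · subst h; simp
    · simp [Finsupp.erase_ne h]
  simp only [hermiteMulti_update, herase, Finsupp.add_apply, Finsupp.single_eq_same] at s1 s2 s3 ⊢
  exact integral_hermiteN_smul_deriv hy (α j) _ s1 s2 s3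

/-- Bessel's inequality for the Hermite coefficients of a Hilbert space valued function. -/
lemma sum_norm_hermiteCoeff_sq_le {X : Type*} [NormedAddCommGroup X] [InnerProductSpace ℝ X]
    [CompleteSpace X] {w : (ℕ → ℝ) → X} (hw : MemLp w 2 gaussian) (s : Finset (ℕ →₀ ℕ)) :
    ∑ ν ∈ s, ‖hermiteCoeff w ν‖ ^ 2 ≤ ∫ y, ‖w y‖ ^ 2 ∂gaussian := by
  set c := hermiteCoeff w with hc
  -- The integral of this nonnegative square is ∫ ‖w‖² - 2 ∑ ‖c_ν‖² + ∑ ‖c_ν‖² by orthonormality.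
  have hexp : ∀ y, ‖w y - ∑ ν ∈ s, hermiteMulti ν y • c ν‖ ^ 2 =
      ‖w y‖ ^ 2 - 2 * (∑ ν ∈ s, inner ℝ (c ν) (hermiteMulti ν y • w y)) +
        ∑ ν ∈ s, ∑ μ ∈ s, (hermiteMulti ν y * hermiteMulti μ y) * inner ℝ (c ν) (c μ) := by
    intro y
    rw [@norm_sub_sq_real, inner_sum, ← real_inner_self_eq_norm_sq (∑ ν ∈ s, _), sum_inner]
    congr 1
    · congr 2
      refine Finset.sum_congr rfl fun ν _ => ?_
      rw [inner_smul_right, inner_smul_right, real_inner_comm]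
    · refine Finset.sum_congr rfl fun ν _ => ?_
      rw [inner_sum]
      refine Finset.sum_congr rfl fun μ _ => ?_
      rw [inner_smul_left, inner_smul_right]
      simp; ring
  have i1 : Integrable (fun y => ‖w y‖ ^ 2) gaussian := by
    simpa using hw.integrable_norm_pow (by norm_num)
  have i2 : Integrable (fun y => ∑ ν ∈ s, inner ℝ (c ν) (hermiteMulti ν y • w y)) gaussian :=
    integrable_finsetSum _ fun ν _ => (integrable_hermiteMulti_smul hw ν).const_inner _
  have i3 : Integrable (fun y => ∑ ν ∈ s, ∑ μ ∈ s,
      (hermiteMulti ν y * hermiteMulti μ y) * inner ℝ (c ν) (c μ)) gaussian :=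
    integrable_finsetSum _ fun ν _ => integrable_finsetSum _ fun μ _ =>
      (integrable_hermiteMulti_mul ν μ).1.mul_const _
  have hnn : 0 ≤ ∫ y, ‖w y - ∑ ν ∈ s, hermiteMulti ν y • c ν‖ ^ 2 ∂gaussian :=
    integral_nonneg fun y => by positivity
  simp only [hexp] at hnn
  rw [integral_add (by exact i1.sub (i2.const_mul 2)) i3, integral_sub i1 (i2.const_mul 2),
    integral_const_mul, integral_finsetSum _ fun ν _ =>
      (integrable_hermiteMulti_smul hw ν).const_inner _,
    integral_finsetSum _ fun ν _ => integrable_finsetSum _ fun μ _ =>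
      (integrable_hermiteMulti_mul ν μ).1.mul_const _] at hnn
  have e2 : ∀ ν ∈ s, ∫ y, inner ℝ (c ν) (hermiteMulti ν y • w y) ∂gaussian = ‖c ν‖ ^ 2 := by
    intro ν _
    rw [integral_inner (integrable_hermiteMulti_smul hw ν)]
    exact real_inner_self_eq_norm_sq (c ν)
  have e3 : ∀ ν ∈ s, ∫ y, ∑ μ ∈ s,
      (hermiteMulti ν y * hermiteMulti μ y) * inner ℝ (c ν) (c μ) ∂gaussian = ‖c ν‖ ^ 2 := by
    intro ν hν
    rw [integral_finsetSum _ fun μ _ => (integrable_hermiteMulti_mul ν μ).1.mul_const _]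
    simp only [integral_mul_const, (integrable_hermiteMulti_mul ν _).2]
    simp [hν]
  rw [Finset.sum_congr rfl e2, Finset.sum_congr rfl e3] at hnn
  linarith

/-! ### Sums over finitely supported multi-indices -/

/-- Distributivity; `ha` lets the product over the support be extended to all of `s`. -/
lemma sum_finsupp_prod (s : Finset ℕ) (t : ℕ → Finset ℕ) (a : ℕ → ℕ → ℝ) (ha : ∀ j, a j 0 = 1) :
    ∑ ν ∈ s.finsupp t, ν.prod a = ∏ j ∈ s, ∑ k ∈ t j, a j k := by
  rw [Finset.prod_sum, Finset.finsupp, Finset.sum_map]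
  refine Finset.sum_congr (by congr!) fun p _ => ?_
  rw [Finsupp.prod_of_support_subset _ (s := s) (by
    exact Finsupp.support_indicator_subset _ _) a fun i _ => ha i, ← Finset.prod_attach]
  refine Finset.prod_congr rfl fun i _ => ?_
  simp [Finsupp.indicator_apply]

lemma exists_subset_finsupp_range (T : Finset (ℕ →₀ ℕ)) :
    ∃ (s : Finset ℕ) (K : ℕ), T ⊆ s.finsupp fun _ => Finset.range (K + 1) := by
  classical
  refine ⟨T.biUnion Finsupp.support, ∑ ν ∈ T, ∑ j ∈ ν.support, ν j, fun ν hν => ?_⟩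
  rw [Finset.mem_finsupp_iff]
  refine ⟨Finset.subset_biUnion_of_mem Finsupp.support hν, fun i _ => ?_⟩
  rw [Finset.mem_range, Nat.lt_succ_iff]
  by_cases hi : i ∈ ν.support
  · calc ν i ≤ ∑ j ∈ ν.support, ν j := Finset.single_le_sum (fun _ _ => Nat.zero_le _) hi
      _ ≤ _ := Finset.single_le_sum (f := fun ν : ℕ →₀ ℕ => ∑ j ∈ ν.support, ν j)
        (fun _ _ => Nat.zero_le _) hν
  · rw [Finsupp.notMem_support_iff.1 hi]; exact Nat.zero_le _

/-- Any finite set of multi-indices lies in a box, over which the sum factorises and is at most ∏ (1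
+ S_j) ≤ exp (∑ S_j). -/
lemma summable_finsupp_prod {a : ℕ → ℕ → ℝ} (ha : ∀ j, a j 0 = 1) (hnn : ∀ j k, 0 ≤ a j k)
    {S : ℕ → ℝ} (hS : Summable S) (hle : ∀ j K, ∑ k ∈ Finset.range K, a j (k + 1) ≤ S j) :
    Summable fun ν : ℕ →₀ ℕ => ν.prod a := by
  have hS0 : ∀ j, 0 ≤ S j := fun j => by simpa using hle j 0
  refine summable_of_sum_le (c := Real.exp (∑' j, S j))
    (fun ν => Finset.prod_nonneg fun j _ => hnn _ _) fun T => ?_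
  obtain ⟨s, K, hT⟩ := exists_subset_finsupp_range T
  calc ∑ ν ∈ T, ν.prod a ≤ ∑ ν ∈ s.finsupp fun _ => Finset.range (K + 1), ν.prod a :=
        Finset.sum_le_sum_of_subset_of_nonneg hT fun ν _ _ =>
          Finset.prod_nonneg fun j _ => hnn _ _
    _ = ∏ j ∈ s, ∑ k ∈ Finset.range (K + 1), a j k := sum_finsupp_prod _ _ _ ha
    _ ≤ ∏ j ∈ s, Real.exp (S j) := by
        refine Finset.prod_le_prod (fun j _ => Finset.sum_nonneg fun k _ => hnn _ _) fun j _ => ?_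
        rw [Finset.sum_range_succ', ha]
        have := hle j K
        have h2 := Real.add_one_le_exp (S j)
        linarith
    _ = Real.exp (∑ j ∈ s, S j) := (Real.exp_sum s S).symm
    _ ≤ _ := Real.exp_le_exp.2 (hS.sum_le_tsum s fun j _ => hS0 j)

/-! ### Summability of negative powers of the weights -/

lemma betaFactor_zero (r : ℕ) (x : ℝ) :
    ∑ l ∈ Finset.range (r + 1), ((0 : ℕ).choose l : ℝ) * x ^ (2 * l) = 1 := by
  rw [Finset.sum_range_succ']
  simp

lemma betaFactor_pos (r k : ℕ) (x : ℝ) :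
    0 < ∑ l ∈ Finset.range (r + 1), (k.choose l : ℝ) * x ^ (2 * l) := by
  rw [Finset.sum_range_succ']
  have : 0 ≤ ∑ l ∈ Finset.range r, (k.choose (l + 1) : ℝ) * x ^ (2 * (l + 1)) :=
    Finset.sum_nonneg fun l _ => mul_nonneg (by positivity) (by rw [pow_mul]; positivity)
  simp only [Nat.choose_zero_right, Nat.cast_one, mul_zero, pow_zero, mul_one]
  linarith

lemma le_betaFactor {r k l : ℕ} (hl : l ≤ r) (x : ℝ) :
    (k.choose l : ℝ) * x ^ (2 * l) ≤
      ∑ l ∈ Finset.range (r + 1), (k.choose l : ℝ) * x ^ (2 * l) :=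
  Finset.single_le_sum (f := fun l => (k.choose l : ℝ) * x ^ (2 * l))
    (fun l _ => mul_nonneg (by positivity) (by rw [pow_mul]; positivity))
    (Finset.mem_range.2 (Nat.lt_succ_of_le hl))

lemma beta_pos (r : ℕ) (ϱ : ℕ → ℝ) (ν : ℕ →₀ ℕ) : 0 < beta r ϱ ν :=
  Finset.prod_pos fun _ _ => betaFactor_pos _ _ _

/-- Since binom(k+r, r) ≥ (k+1)^r / r!, the terms decay like k^{-rq/2}, and rq/2 > 1. -/
lemma summable_choose_rpow {q : ℝ} (hq : 0 < q) {r : ℕ} (hr : 2 / q < (r : ℝ)) :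
    Summable fun k : ℕ => (((k + r).choose r : ℕ) : ℝ) ^ (-(q / 2)) := by
  have hrq : 1 < (r : ℝ) * (q / 2) := by
    rw [div_lt_iff₀ hq] at hr; linarith
  have h1 : Summable fun k : ℕ => ((r ! : ℕ) : ℝ) ^ (q / 2) *
      (((k + 1 : ℕ) : ℝ) ^ ((r : ℝ) * (q / 2)))⁻¹ := by
    refine Summable.mul_left _ ?_
    exact (summable_nat_add_iff 1).2 (Real.summable_nat_rpow_inv.2 hrq)
  refine Summable.of_nonneg_of_le (fun k => by positivity) (fun k => ?_) h1
  have hp := Nat.pow_le_choose (α := ℝ) r (k + r)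
  have hk : k + r + 1 - r = k + 1 := by omega
  rw [hk] at hp
  have hkpos : (0 : ℝ) < ((k + 1 : ℕ) : ℝ) := by positivity
  have hfac : (0 : ℝ) < (r ! : ℕ) := by positivity
  have hle : ((k + 1 : ℕ) : ℝ) ^ r / (r ! : ℕ) ≤ ((k + r).choose r : ℕ) := hp
  have h2 := Real.rpow_le_rpow_of_nonpos (z := -(q / 2)) (by positivity) hle (by linarith)
  refine h2.trans (le_of_eq ?_)
  rw [Real.rpow_neg (by positivity), Real.div_rpow (by positivity) hfac.le,
    ← Real.rpow_natCast, ← Real.rpow_mul hkpos.le, inv_div, div_eq_mul_inv]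

lemma exists_inv_le_of_memℓp {q : ℝ} {ϱ : ℕ → ℝ}
    (hϱq : Memℓp (fun j => (ϱ j)⁻¹) (ENNReal.ofReal q)) :
    ∃ A : ℝ, 0 < A ∧ ∀ j, (ϱ j)⁻¹ ≤ A := by
  obtain ⟨A, hA⟩ := (hϱq.of_exponent_ge (le_top : ENNReal.ofReal q ≤ ⊤)).bddAbove
  refine ⟨max A 1, by positivity, fun j => ?_⟩
  exact (le_abs_self _).trans ((hA ⟨j, rfl⟩).trans (le_max_left _ _))

lemma summable_rpow_of_memℓp {q : ℝ} (hq : 0 < q) {ϱ : ℕ → ℝ} (hϱ : ∀ j, 0 < ϱ j)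
    (hϱq : Memℓp (fun j => (ϱ j)⁻¹) (ENNReal.ofReal q)) : Summable fun j => ϱ j ^ (-q) := by
  have h := (memℓp_gen_iff (by rwa [ENNReal.toReal_ofReal hq.le])).1 hϱq
  rw [ENNReal.toReal_ofReal hq.le] at h
  refine h.congr fun j => ?_
  rw [Real.norm_of_nonneg (inv_nonneg.2 (hϱ j).le), Real.rpow_neg (hϱ j).le,
    Real.inv_rpow (hϱ j).le]

lemma memℓp_beta {q : ℝ} (hq : 0 < q) {ϱ : ℕ → ℝ} (hϱ : ∀ j, 0 < ϱ j)
    (hϱq : Memℓp (fun j => (ϱ j)⁻¹) (ENNReal.ofReal q)) {r : ℕ} (hr : 2 / q < (r : ℝ)) :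
    Memℓp (fun ν : ℕ →₀ ℕ => beta r ϱ ν ^ (-(1 / 2) : ℝ)) (ENNReal.ofReal q) := by
  have hr1 : 1 ≤ r := by
    have : (0 : ℝ) < r := lt_trans (by positivity) hr
    exact_mod_cast this
  obtain ⟨A, hA0, hA⟩ := exists_inv_le_of_memℓp hϱq
  rw [memℓp_gen_iff (by rwa [ENNReal.toReal_ofReal hq.le]), ENNReal.toReal_ofReal hq.le]
  set B : ℕ → ℕ → ℝ := fun j k => ∑ l ∈ Finset.range (r + 1), (k.choose l : ℝ) * ϱ j ^ (2 * l)
    with hB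
  have hBpos : ∀ j k, 0 < B j k := fun j k => betaFactor_pos _ _ _
  -- For 1 ≤ k < r the binomial binom(k, r) vanishes, so the term l = 1 of the weight is used. For k
  -- ≥ r the term l = r gives decay in k, and the surplus ϱ_j^{-q(r-1)} is absorbed by the bound A.
  set c : ℕ → ℝ := fun k => if k < r then 1 else ((k.choose r : ℕ) : ℝ) ^ (-(q / 2)) *
    A ^ (q * ((r : ℝ) - 1)) with hc
  have hcsum : Summable c := by
    rw [← summable_nat_add_iff r]
    refine ((summable_choose_rpow hq hr).mul_right (A ^ (q * ((r : ℝ) - 1)))).congr fun k => ?_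
    simp [hc]
  have hc0 : ∀ k, 0 ≤ c k := fun k => by
    simp only [hc]; split_ifs <;> positivity
  have hle : ∀ j k, 1 ≤ k → B j k ^ (-(q / 2)) ≤ c k * ϱ j ^ (-q) := by
    intro j k hk
    have hj := hϱ j
    simp only [hc]
    split_ifs with hkr
    · have h1 : ϱ j ^ 2 ≤ B j k := by
        refine le_trans ?_ (le_betaFactor (k := k) hr1 (ϱ j))
        have : (1 : ℝ) ≤ k := by exact_mod_cast hk
        simp only [Nat.choose_one_right, mul_one]
        nlinarith [sq_nonneg (ϱ j)]
      refine (Real.rpow_le_rpow_of_nonpos (by positivity) h1 (by linarith)).trans (le_of_eq ?_)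
      rw [← Real.rpow_natCast, ← Real.rpow_mul hj.le, one_mul]
      congr 1; push_cast; ring
    · push Not at hkr
      have hch : (0 : ℝ) < (k.choose r : ℕ) := by exact_mod_cast Nat.choose_pos hkr
      have h1 := le_betaFactor (k := k) (le_refl r) (ϱ j)
      refine (Real.rpow_le_rpow_of_nonpos (by positivity) h1 (by linarith)).trans ?_
      rw [Real.mul_rpow hch.le (by positivity), mul_assoc]
      refine mul_le_mul_of_nonneg_left ?_ (by positivity)
      have e1 : (ϱ j ^ (2 * r)) ^ (-(q / 2)) = ϱ j ^ (-(q * ((r : ℝ) - 1))) * ϱ j ^ (-q) := by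
        rw [← Real.rpow_natCast, ← Real.rpow_mul hj.le, ← Real.rpow_add hj]
        congr 1; push_cast; ring
      rw [e1]
      refine mul_le_mul_of_nonneg_right ?_ (by positivity)
      rw [Real.rpow_neg hj.le, ← Real.inv_rpow hj.le]
      refine Real.rpow_le_rpow (by positivity) (hA j) (mul_nonneg hq.le ?_)
      have : (1 : ℝ) ≤ r := by exact_mod_cast hr1
      linarith
  have hmain := summable_finsupp_prod (a := fun j k => B j k ^ (-(q / 2)))
    (fun j => by simp only [hB, betaFactor_zero, Real.one_rpow])
    (fun j k => (Real.rpow_pos_of_pos (hBpos j k) _).le)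
    (S := fun j => (∑' k, c k) * ϱ j ^ (-q)) ((summable_rpow_of_memℓp hq hϱ hϱq).mul_left _)
    (fun j K => by
      have hcs : Summable fun k => c (k + 1) := (summable_nat_add_iff 1).2 hcsum
      calc ∑ k ∈ Finset.range K, B j (k + 1) ^ (-(q / 2))
          ≤ ∑ k ∈ Finset.range K, c (k + 1) * ϱ j ^ (-q) :=
            Finset.sum_le_sum fun k _ => hle j (k + 1) (by omega)
        _ = (∑ k ∈ Finset.range K, c (k + 1)) * ϱ j ^ (-q) := (Finset.sum_mul _ _ _).symm
        _ ≤ _ := by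
          refine mul_le_mul_of_nonneg_right ?_ (Real.rpow_pos_of_pos (hϱ j) _).le
          refine (hcs.sum_le_tsum _ fun k _ => hc0 _).trans ?_
          rw [hcsum.tsum_eq_zero_add]
          linarith [hc0 0])
  refine hmain.congr fun ν => ?_
  rw [Real.norm_of_nonneg (Real.rpow_pos_of_pos (beta_pos _ _ _) _).le,
    ← Real.rpow_mul (beta_pos _ _ _).le, beta, Finsupp.prod, Finsupp.prod,
    ← Real.finsetProd_rpow _ _ fun j _ => (betaFactor_pos _ _ _).le]
  refine Finset.prod_congr rfl fun j _ => ?_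
  simp only [hB]
  congr 1; ring

/-- Hölder in pointwise form: v^p = (b^{-q/2})^{p/q} (b v²)^{p/2} with p/q + p/2 = 1, so weighted
AM-GM bounds v^p by a combination of two summable terms. -/
lemma memℓp_of_weighted {q p : ℝ} (hq : 0 < q) (hp : 1 / p = 1 / q + 1 / 2) {ι : Type*}
    {b v : ι → ℝ} (hb : ∀ i, 0 < b i) (hv : ∀ i, 0 ≤ v i)
    (hs : Summable fun i => b i * v i ^ 2)
    (hbq : Memℓp (fun i => b i ^ (-(1 / 2) : ℝ)) (ENNReal.ofReal q)) :
    Memℓp v (ENNReal.ofReal p) := by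
  have hp0 : 0 < p := by
    have : 0 < 1 / p := by rw [hp]; positivity
    exact one_div_pos.1 this
  rw [memℓp_gen_iff (by rwa [ENNReal.toReal_ofReal hq.le]), ENNReal.toReal_ofReal hq.le] at hbq
  rw [memℓp_gen_iff (by rwa [ENNReal.toReal_ofReal hp0.le]), ENNReal.toReal_ofReal hp0.le]
  have hsum : p / q + p / 2 = 1 := by
    have : p * (1 / p) = p * (1 / q + 1 / 2) := by rw [hp]
    rw [mul_one_div_cancel hp0.ne'] at this
    rw [this]; ring
  refine Summable.of_nonneg_of_le (fun i => by positivity) (fun i => ?_)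
    ((hbq.mul_left (p / q)).add (hs.mul_left (p / 2)))
  have hy := Real.geom_mean_le_arith_mean2_weighted (w₁ := p / q) (w₂ := p / 2)
    (p₁ := ‖b i ^ (-(1 / 2) : ℝ)‖ ^ q) (p₂ := b i * v i ^ 2) (by positivity) (by positivity)
    (by positivity) (mul_nonneg (hb i).le (sq_nonneg _)) hsum
  refine le_trans (le_of_eq ?_) hy
  rw [Real.norm_of_nonneg (hv i), Real.norm_of_nonneg (Real.rpow_pos_of_pos (hb i) _).le,
    ← Real.rpow_mul (hb i).le, ← Real.rpow_mul (hb i).le,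
    Real.mul_rpow (hb i).le (sq_nonneg _), ← mul_assoc, ← Real.rpow_add (hb i),
    ← Real.rpow_natCast (v i), ← Real.rpow_mul (hv i)]
  have e1 : -(1 / 2) * q * (p / q) + p / 2 = 0 := by field_simp; ring
  have e2 : ((2 : ℕ) : ℝ) * (p / 2) = p := by push_cast; ring
  rw [e1, e2, Real.rpow_zero, one_mul]

/-! ### Expansion of the weights in multinomial coefficients -/

/-- The multinomial coefficient `∏_j (ν_j choose μ_j)`. -/
def multiChoose (ν μ : ℕ →₀ ℕ) : ℝ := μ.prod fun j m => ((ν j).choose m : ℝ)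

lemma multiPow_two_smul (c : ℕ → ℝ) (μ : ℕ →₀ ℕ) :
    multiPow c (2 • μ) = μ.prod fun j m => c j ^ (2 * m) := by
  unfold multiPow
  rw [Finsupp.prod_of_support_subset (2 • μ) (s := μ.support) ?_ _ fun i _ => pow_zero _]
  · exact Finset.prod_congr rfl fun i _ => by simp
  · exact Finsupp.support_smul

lemma beta_eq_sum {s : Finset ℕ} {ν : ℕ →₀ ℕ} (hs : ν.support ⊆ s) (r : ℕ) (ϱ : ℕ → ℝ) :
    beta r ϱ ν = ∑ μ ∈ s.finsupp fun _ => Finset.range (r + 1),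
      multiChoose ν μ * multiPow ϱ (2 • μ) := by
  unfold beta
  rw [Finsupp.prod_of_support_subset _ hs _ fun i _ => betaFactor_zero r (ϱ i),
    ← sum_finsupp_prod s (fun _ => Finset.range (r + 1))
      (fun j l => ((ν j).choose l : ℝ) * ϱ j ^ (2 * l)) fun j => by simp]
  refine Finset.sum_congr rfl fun μ _ => ?_
  rw [multiPow_two_smul, multiChoose, Finsupp.prod_mul]

lemma multiChoose_eq_zero {ν μ : ℕ →₀ ℕ} (h : ¬ μ ≤ ν) : multiChoose ν μ = 0 := by
  rw [Finsupp.le_def] at h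
  push Not at h
  obtain ⟨i, hi⟩ := h
  refine Finset.prod_eq_zero (i := i) ?_ ?_
  · rw [Finsupp.mem_support_iff]; omega
  · simp [Nat.choose_eq_zero_of_lt hi]

/-- Expand the weight over μ and exchange the two sums: a bound for each fixed μ then suffices,
which is the form that Bessel's inequality delivers. -/
lemma summable_beta_mul {r : ℕ} {ϱ : ℕ → ℝ} (hϱ : ∀ j, 0 < ϱ j) {v B : (ℕ →₀ ℕ) → ℝ}
    (hB0 : ∀ μ, 0 ≤ B μ)
    (hv : ∀ ν, 0 ≤ v ν)
    (hB : ∀ μ, ∀ T : Finset (ℕ →₀ ℕ), ∑ α ∈ T, multiChoose (α + μ) μ * v (α + μ) ≤ B μ)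
    (hsum : Summable fun μ : {μ : ℕ →₀ ℕ // ∀ j, μ j ≤ r} => multiPow ϱ (2 • μ.1) * B μ.1) :
    Summable fun ν => beta r ϱ ν * v ν := by
  classical
  have hpow : ∀ μ : ℕ →₀ ℕ, 0 ≤ multiPow ϱ μ := fun μ =>
    Finset.prod_nonneg fun j _ => pow_nonneg (hϱ j).le _
  refine summable_of_sum_le (c := ∑' μ : {μ : ℕ →₀ ℕ // ∀ j, μ j ≤ r},
    multiPow ϱ (2 • μ.1) * B μ.1) (fun ν => mul_nonneg (beta_pos _ _ _).le (hv ν)) fun T => ?_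
  set s := T.biUnion Finsupp.support
  set M := s.finsupp fun _ => Finset.range (r + 1)
  have hM : ∀ μ ∈ M, ∀ j, μ j ≤ r := by
    intro μ hμ j
    rw [Finset.mem_finsupp_iff] at hμ
    by_cases hj : j ∈ s
    · exact Nat.lt_succ_iff.1 (Finset.mem_range.1 (hμ.2 j hj))
    · rw [Finsupp.notMem_support_iff.1 fun h => hj (hμ.1 h)]; exact Nat.zero_le _
  calc ∑ ν ∈ T, beta r ϱ ν * v ν
      = ∑ ν ∈ T, ∑ μ ∈ M, multiPow ϱ (2 • μ) * (multiChoose ν μ * v ν) := by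
        refine Finset.sum_congr rfl fun ν hν => ?_
        rw [beta_eq_sum (Finset.subset_biUnion_of_mem Finsupp.support hν), Finset.sum_mul]
        exact Finset.sum_congr rfl fun μ _ => by ring
    _ = ∑ μ ∈ M, multiPow ϱ (2 • μ) * ∑ ν ∈ T, multiChoose ν μ * v ν := by
        rw [Finset.sum_comm]
        exact Finset.sum_congr rfl fun μ _ => (Finset.mul_sum _ _ _).symm
    _ ≤ ∑ μ ∈ M, multiPow ϱ (2 • μ) * B μ := by
        refine Finset.sum_le_sum fun μ _ => mul_le_mul_of_nonneg_left ?_ (hpow _)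
        -- Only ν ≥ μ contribute, and on these ν ↦ ν - μ is injective, which reindexes the sum by α.
        rw [← Finset.sum_filter_of_ne (p := fun ν => μ ≤ ν) fun ν _ hne => by
          by_contra hcon
          exact hne (by rw [multiChoose_eq_zero hcon, zero_mul])]
        refine le_trans (le_of_eq ?_) (hB μ ((T.filter fun ν => μ ≤ ν).image fun ν => ν - μ))
        rw [Finset.sum_image]
        · refine Finset.sum_congr rfl fun ν hν => ?_
          rw [tsub_add_cancel_of_le (Finset.mem_filter.1 hν).2]
        · intro a ha b hb hab
          have h1 := tsub_add_cancel_of_le (Finset.mem_filter.1 ha).2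
          have h2 := tsub_add_cancel_of_le (Finset.mem_filter.1 hb).2
          simp only at hab
          rw [← h1, ← h2, hab]
    _ = ∑ μ ∈ M.subtype (fun μ => ∀ j, μ j ≤ r), multiPow ϱ (2 • μ.1) * B μ.1 := by
        rw [← Finset.sum_subtype_of_mem (fun μ => multiPow ϱ (2 • μ) * B μ) hM]
    _ ≤ _ := hsum.sum_le_tsum _ fun μ _ => mul_nonneg (hpow _) (hB0 _)

/-! ### Multiplication operators and the complex solution operator -/

/-- Compression is a bounded linear map of the operator, hence preserves analyticity. -/
lemma analyticAt_compression {A H L : Type*} [NormedAddCommGroup A] [NormedSpace ℂ A]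
    [NormedAddCommGroup H] [NormedSpace ℂ H] [NormedAddCommGroup L] [NormedSpace ℂ L]
    (P : H →L[ℂ] L) (J : L →L[ℂ] H) {T : A → H →L[ℂ] H} {b : A} (hT : AnalyticAt ℂ T b) :
    AnalyticAt ℂ (fun b => P ∘L T b ∘L J) b :=
  AnalyticAt.comp (g := (ContinuousLinearMap.compL ℂ L H L P).comp
    ((ContinuousLinearMap.compL ℂ L H H).flip J)) (ContinuousLinearMap.analyticAt _ _) hT

section Operators

variable {Ω : Type*} [MeasurableSpace Ω] {m : Measure Ω}

lemma Lp.ae_norm_le {E : Type*} [NormedAddCommGroup E] (f : Lp E ⊤ m) :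
    ∀ᵐ x ∂m, ‖f x‖ ≤ ‖f‖ := by
  filter_upwards [ae_le_eLpNormEssSup (f := f) (μ := m)] with x hx
  rw [Lp.norm_def, eLpNorm_exponent_top, ← toReal_enorm]
  refine ENNReal.toReal_mono ?_ hx
  rw [← eLpNorm_exponent_top]
  exact Lp.eLpNorm_ne_top f

lemma Lp.norm_le_of_ae {E : Type*} [NormedAddCommGroup E] {f : Lp E ⊤ m} {C : ℝ} (hC : 0 ≤ C)
    (h : ∀ᵐ x ∂m, ‖f x‖ ≤ C) : ‖f‖ ≤ C := by
  rw [Lp.norm_def, eLpNorm_exponent_top]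
  refine ENNReal.toReal_le_of_le_ofReal hC ?_
  exact eLpNormEssSup_le_of_ae_bound h

/-- The real part of an essentially bounded function. -/
def reL : Lp ℂ ⊤ m →L[ℝ] Lp ℝ ⊤ m := Complex.reCLM.compLpL ⊤ m

/-- The imaginary part of an essentially bounded function. -/
def imL : Lp ℂ ⊤ m →L[ℝ] Lp ℝ ⊤ m := Complex.imCLM.compLpL ⊤ m

/-- A real essentially bounded function, regarded as a complex one. -/
def toC : Lp ℝ ⊤ m →L[ℝ] Lp ℂ ⊤ m := Complex.ofRealCLM.compLpL ⊤ m

lemma coeFn_reL (b : Lp ℂ ⊤ m) : reL b =ᵐ[m] fun x => (b x).re :=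
  Complex.reCLM.coeFn_compLpL b

lemma coeFn_imL (b : Lp ℂ ⊤ m) : imL b =ᵐ[m] fun x => (b x).im :=
  Complex.imCLM.coeFn_compLpL b

lemma coeFn_toC (b : Lp ℝ ⊤ m) : toC b =ᵐ[m] fun x => (b x : ℂ) :=
  Complex.ofRealCLM.coeFn_compLpL b

lemma norm_reL_le (b : Lp ℂ ⊤ m) : ‖reL b‖ ≤ ‖b‖ := by
  refine Lp.norm_le_of_ae (norm_nonneg _) ?_
  filter_upwards [coeFn_reL b, Lp.ae_norm_le b] with x h1 h2
  rw [h1]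
  exact (Complex.abs_re_le_norm _).trans h2

lemma norm_imL_le (b : Lp ℂ ⊤ m) : ‖imL b‖ ≤ ‖b‖ := by
  refine Lp.norm_le_of_ae (norm_nonneg _) ?_
  filter_upwards [coeFn_imL b, Lp.ae_norm_le b] with x h1 h2
  rw [h1]
  exact (Complex.abs_im_le_norm _).trans h2

lemma reL_toC (b : Lp ℝ ⊤ m) : reL (toC b) = b := by
  refine Lp.ext ?_
  filter_upwards [coeFn_reL (toC b), coeFn_toC b] with x h1 h2
  rw [h1, h2, Complex.ofReal_re]

lemma imL_toC (b : Lp ℝ ⊤ m) : imL (toC b) = 0 := by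
  refine Lp.ext ?_
  filter_upwards [coeFn_imL (toC b), coeFn_toC b, Lp.coeFn_zero ℝ ⊤ m] with x h1 h2 h3
  rw [h1, h2, h3, Complex.ofReal_im]; rfl

variable {E : Type*} [NormedAddCommGroup E] [InnerProductSpace ℂ E]

variable (E m) in
/-- Multiplication by an essentially bounded function, as an operator on `L²`. -/
def mulOp : Lp ℂ ⊤ m →L[ℂ] (Lp E 2 m →L[ℂ] Lp E 2 m) :=
  (ContinuousLinearMap.lsmul ℂ ℂ).holderL m ⊤ 2 2

lemma coeFn_mulOp (b : Lp ℂ ⊤ m) (h : Lp E 2 m) : mulOp m E b h =ᵐ[m] fun x => b x • h x := by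
  unfold mulOp
  rw [ContinuousLinearMap.holderL_apply_apply]
  exact ContinuousLinearMap.coeFn_holder _ _ _

lemma coeFn_mulOp_pow (b : Lp ℂ ⊤ m) (h : Lp E 2 m) (n : ℕ) :
    (mulOp m E b ^ n) h =ᵐ[m] fun x => b x ^ n • h x := by
  induction n with
  | zero => simp
  | succ n ih =>
    rw [pow_succ']
    filter_upwards [coeFn_mulOp b ((mulOp m E b ^ n) h), ih] with x h1 h2
    rw [mul_apply_eq_comp, h1, h2, smul_smul, pow_succ']

variable [CompleteSpace E]

/-- Defining the coefficient operator as an operator exponential makes its analyticity in b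
immediate. To see that it is multiplication by exp b, pass to a subsequence of the partial sums
converging almost everywhere. -/
lemma coeFn_exp_mulOp (b : Lp ℂ ⊤ m) (h : Lp E 2 m) :
    NormedSpace.exp (mulOp m E b) h =ᵐ[m] fun x => Complex.exp (b x) • h x := by
  have hs := (NormedSpace.exp_series_hasSum_exp' (𝕂 := ℂ) (mulOp m E b)).mapL
    (ContinuousLinearMap.apply ℂ (Lp E 2 m) h)
  obtain ⟨ns, hns, hae⟩ := (tendstoInMeasure_of_tendsto_Lp
    hs.tendsto_sum_nat).exists_seq_tendsto_ae
  have hpart : ∀ᵐ x ∂m, ∀ n : ℕ, (∑ i ∈ Finset.range n, ContinuousLinearMap.apply ℂ (Lp E 2 m) h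
      ((i !⁻¹ : ℂ) • mulOp m E b ^ i) : Lp E 2 m) x =
      (∑ i ∈ Finset.range n, (i !⁻¹ : ℂ) • b x ^ i) • h x := by
    rw [ae_all_iff]
    intro n
    induction n with
    | zero =>
      filter_upwards [Lp.coeFn_zero E 2 m] with x hx
      simp only [Finset.range_zero, Finset.sum_empty, zero_smul]
      exact hx
    | succ n ih =>
      rw [Finset.sum_range_succ]
      filter_upwards [ih, Lp.coeFn_add (∑ i ∈ Finset.range n,
        ContinuousLinearMap.apply ℂ (Lp E 2 m) h ((i !⁻¹ : ℂ) • mulOp m E b ^ i))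
        (ContinuousLinearMap.apply ℂ (Lp E 2 m) h ((n !⁻¹ : ℂ) • mulOp m E b ^ n)),
        Lp.coeFn_smul (n !⁻¹ : ℂ) ((mulOp m E b ^ n) h), coeFn_mulOp_pow b h n] with x h1 h2 h3 h4
      rw [h2, Pi.add_apply, h1, Finset.sum_range_succ, add_smul]
      congr 1
      simp only [ContinuousLinearMap.apply_apply, smul_apply] at h3 ⊢
      rw [h3, Pi.smul_apply, h4, smul_assoc]
  filter_upwards [hae, hpart] with x hx hp
  have h1 := ((NormedSpace.exp_series_hasSum_exp' (𝕂 := ℂ) (b x)).tendsto_sum_nat.comp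
    hns.tendsto_atTop).smul_const (h x)
  rw [← Complex.exp_eq_exp_ℂ] at h1
  refine tendsto_nhds_unique hx ?_
  refine h1.congr fun i => ?_
  simp only [Function.comp_apply]
  exact (hp (ns i)).symm

/-- The ellipticity constant of `exp b`. -/
def ellipticity (b : Lp ℂ ⊤ m) : ℝ := Real.exp (-‖reL b‖) * Real.cos ‖imL b‖

lemma ellipticity_pos {b : Lp ℂ ⊤ m} (hb : ‖imL b‖ < Real.pi / 2) : 0 < ellipticity b :=
  mul_pos (Real.exp_pos _) (Real.cos_pos_of_mem_Ioo
    ⟨by linarith [norm_nonneg (imL b), Real.pi_pos], hb⟩)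

/-- From Re exp(b) = exp(Re b) cos(Im b); this is the origin of the threshold π/2. -/
lemma ellipticity_le_re_exp {b : Lp ℂ ⊤ m} (hb : ‖imL b‖ < Real.pi / 2) :
    ∀ᵐ x ∂m, ellipticity b ≤ (Complex.exp (b x)).re := by
  filter_upwards [coeFn_imL b, coeFn_reL b, Lp.ae_norm_le (imL b), Lp.ae_norm_le (reL b)]
    with x h1 h2 h3 h4
  rw [h1, Real.norm_eq_abs] at h3
  rw [h2, Real.norm_eq_abs] at h4
  rw [Complex.exp_re]
  refine mul_le_mul (Real.exp_le_exp.2 ?_) ?_ ?_ (Real.exp_pos _).le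
  · linarith [neg_abs_le (b x).re]
  · rw [← Real.cos_abs (b x).im]
    exact Real.cos_le_cos_of_nonneg_of_le_pi (abs_nonneg _) (by linarith [Real.pi_pos]) h3
  · exact (Real.cos_pos_of_mem_Ioo
      ⟨by linarith [norm_nonneg (imL b), Real.pi_pos], hb⟩).le

lemma re_inner_exp_mulOp_ge {b : Lp ℂ ⊤ m} (hb : ‖imL b‖ < Real.pi / 2) (h : Lp E 2 m) :
    ellipticity b * ‖h‖ ^ 2 ≤ RCLike.re (inner ℂ (NormedSpace.exp (mulOp m E b) h) h) := by
  have e1 : ‖h‖ ^ 2 = ∫ x, ‖h x‖ ^ 2 ∂m := by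
    rw [← inner_self_eq_norm_sq (𝕜 := ℂ) h, L2.inner_def, ← integral_re (L2.integrable_inner h h)]
    exact integral_congr_ae (ae_of_all _ fun x => inner_self_eq_norm_sq (h x))
  have i1 : Integrable (fun x => ‖h x‖ ^ 2) m := by
    simpa using (Lp.memLp h).integrable_norm_pow (by norm_num)
  rw [e1, L2.inner_def, ← integral_re (L2.integrable_inner _ _), ← integral_const_mul]
  refine integral_mono_ae (i1.const_mul _) (L2.integrable_inner _ _).re ?_
  filter_upwards [ellipticity_le_re_exp hb, coeFn_exp_mulOp b h] with x h1 h2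
  rw [h2, inner_smul_left, inner_self_eq_norm_sq_to_K]
  have : RCLike.re ((starRingEnd ℂ) (Complex.exp (b x)) * (RCLike.ofReal ‖h x‖ : ℂ) ^ 2) =
      (Complex.exp (b x)).re * ‖h x‖ ^ 2 := by
    rw [← RCLike.ofReal_pow, RCLike.re_mul_ofReal, RCLike.conj_re]
    rfl
  rw [this]
  exact mul_le_mul_of_nonneg_right h1 (by positivity)

variable (K : Submodule ℂ (Lp E 2 m)) [CompleteSpace K]

/-- The compression of the multiplication by `exp b` to the subspace `K`. -/
def formOp (b : Lp ℂ ⊤ m) : K →L[ℂ] K :=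
  K.orthogonalProjectionOnto ∘L (NormedSpace.exp (mulOp m E b)) ∘L K.subtypeL

lemma inner_formOp (b : Lp ℂ ⊤ m) (g k : K) :
    inner ℂ (formOp K b g) k = inner ℂ (NormedSpace.exp (mulOp m E b) (g : Lp E 2 m)) (k : Lp E 2 m) := by
  simp [formOp]

/-- Lax–Milgram, with coercivity supplied by the real part of the form. -/
lemma isUnit_formOp {b : Lp ℂ ⊤ m} (hb : ‖imL b‖ < Real.pi / 2) : IsUnit (formOp K b) := by
  refine ContinuousLinearMap.isUnit_of_forall_le_norm_inner_map _
    (c := ⟨ellipticity b, (ellipticity_pos hb).le⟩) (ellipticity_pos hb) fun g => ?_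
  rw [inner_formOp]
  refine le_trans ?_ (RCLike.re_le_norm _)
  rw [mul_comm]
  exact re_inner_exp_mulOp_ge hb (g : Lp E 2 m)

lemma analyticAt_formOp (b : Lp ℂ ⊤ m) : AnalyticAt ℂ (formOp K) b :=
  analyticAt_compression _ _
    ((NormedSpace.exp_analytic (𝕂 := ℂ) (mulOp m E b)).comp ((mulOp m E).analyticAt b))

/-- The solution of `formOp K b g = F`. -/
def solveOp (F : K) (b : Lp ℂ ⊤ m) : K := Ring.inverse (formOp K b) F

lemma formOp_solveOp (F : K) {b : Lp ℂ ⊤ m} (hb : ‖imL b‖ < Real.pi / 2) :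
    formOp K b (solveOp K F b) = F := by
  have := Ring.mul_inverse_cancel _ (isUnit_formOp K hb)
  exact congrArg (fun A : K →L[ℂ] K => A F) this

lemma eq_solveOp {F g : K} {b : Lp ℂ ⊤ m} (hb : ‖imL b‖ < Real.pi / 2)
    (h : formOp K b g = F) : g = solveOp K F b := by
  have := Ring.inverse_mul_cancel _ (isUnit_formOp K hb)
  have h2 := congrArg (fun A : K →L[ℂ] K => A g) this
  simp only [mul_apply_eq_comp, h, one_apply_eq_self] at h2
  exact h2.symm

/-- Inversion is analytic at invertible operators, and the coefficient operator depends analytically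
on b. -/
lemma analyticAt_solveOp (F : K) {b : Lp ℂ ⊤ m} (hb : ‖imL b‖ < Real.pi / 2) :
    AnalyticAt ℂ (solveOp K F) b := by
  obtain ⟨A, hA⟩ := isUnit_formOp K hb
  have h1 : AnalyticAt ℂ Ring.inverse (formOp K b) := by
    rw [← hA]; exact analyticAt_inverse (𝕜 := ℂ) (A := K →L[ℂ] K) A
  exact ((ContinuousLinearMap.apply ℂ K F).analyticAt _).comp (h1.comp (analyticAt_formOp K b))

lemma norm_solveOp_le (F : K) {b : Lp ℂ ⊤ m} (hb : ‖imL b‖ < Real.pi / 2) :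
    ‖solveOp K F b‖ ≤ ‖F‖ / Real.cos ‖imL b‖ * Real.exp ‖reL b‖ := by
  have hcos : 0 < Real.cos ‖imL b‖ := Real.cos_pos_of_mem_Ioo
    ⟨by linarith [norm_nonneg (imL b), Real.pi_pos], hb⟩
  have hpos := ellipticity_pos hb
  set g := solveOp K F b
  -- Energy estimate: test the equation with its own solution.
  have h1 : ellipticity b * ‖g‖ ^ 2 ≤ ‖F‖ * ‖g‖ := by
    have h2 := re_inner_exp_mulOp_ge hb (g : Lp E 2 m)
    rw [← inner_formOp, formOp_solveOp K F hb] at h2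
    exact h2.trans ((RCLike.re_le_norm _).trans (by exact norm_inner_le_norm (𝕜 := ℂ) F g))
  have h3 : ellipticity b * ‖g‖ ≤ ‖F‖ := by
    rcases (norm_nonneg g).eq_or_lt with h0 | h0
    · rw [← h0, mul_zero]; exact norm_nonneg _
    · refine le_of_mul_le_mul_right ?_ h0
      calc ellipticity b * ‖g‖ * ‖g‖ = ellipticity b * ‖g‖ ^ 2 := by ring
        _ ≤ _ := h1
  calc ‖g‖ ≤ ‖F‖ / ellipticity b := by
        rw [le_div_iff₀ hpos]; linarith
    _ = _ := by
        rw [ellipticity, Real.exp_neg]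
        field_simp

end Operators

/-! ### Directional derivatives of holomorphic functions of the coefficient -/

section Derivatives

variable {Ω : Type*} [MeasurableSpace Ω] {m : Measure Ω}
  {X : Type*} [NormedAddCommGroup X] [NormedSpace ℂ X]

/-- `G` is holomorphic on the strip `‖Im b‖ < π / 2`, with growth `exp ‖Re b‖` on smaller closed
strips. -/
structure IsStripHolomorphic (G : Lp ℂ ⊤ m → X) : Prop where
  analyticAt : ∀ b, ‖imL b‖ < Real.pi / 2 → AnalyticAt ℂ G b
  growth : ∀ s < Real.pi / 2, ∃ C, 0 ≤ C ∧ ∀ b, ‖imL b‖ ≤ s → ‖G b‖ ≤ C * Real.exp ‖reL b‖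

/-- The derivative in the direction `ψ`. -/
def dirDeriv (ψ : Lp ℂ ⊤ m) (G : Lp ℂ ⊤ m → X) (b : Lp ℂ ⊤ m) : X := fderiv ℂ G b ψ

lemma hasDerivAt_line {G : Lp ℂ ⊤ m → X} {b ψ : Lp ℂ ⊤ m} {ζ : ℂ}
    (h : AnalyticAt ℂ G (b + ζ • ψ)) :
    HasDerivAt (fun ζ : ℂ => G (b + ζ • ψ)) (dirDeriv ψ G (b + ζ • ψ)) ζ := by
  have h1 : HasDerivAt (fun ζ : ℂ => b + ζ • ψ) ψ ζ := by
    simpa using ((hasDerivAt_id ζ).smul_const ψ).const_add b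
  exact h.differentiableAt.hasFDerivAt.comp_hasDerivAt ζ h1

lemma hasDerivAt_real_line {G : Lp ℂ ⊤ m → X} {b ψ : Lp ℂ ⊤ m} {a t : ℝ}
    (h : AnalyticAt ℂ G (b + (((t - a : ℝ) : ℂ)) • ψ)) :
    HasDerivAt (fun t : ℝ => G (b + ((t - a : ℝ) : ℂ) • ψ))
      (dirDeriv ψ G (b + ((t - a : ℝ) : ℂ) • ψ)) t := by
  have h1 := hasDerivAt_line h
  have h2 : HasDerivAt (fun t : ℝ => ((t - a : ℝ) : ℂ)) 1 t := by
    simpa using ((hasDerivAt_id t).sub_const a).ofReal_comp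
  have h3 := h1.scomp t h2
  rw [one_smul] at h3
  exact h3

lemma norm_imL_line_le (b ψ : Lp ℂ ⊤ m) (ζ : ℂ) :
    ‖imL (b + ζ • ψ)‖ ≤ ‖imL b‖ + ‖ζ‖ * ‖ψ‖ := by
  rw [map_add]
  refine (norm_add_le _ _).trans (add_le_add le_rfl ((norm_imL_le _).trans ?_))
  rw [norm_smul]

lemma norm_reL_line_le (b ψ : Lp ℂ ⊤ m) (ζ : ℂ) :
    ‖reL (b + ζ • ψ)‖ ≤ ‖reL b‖ + ‖ζ‖ * ‖ψ‖ := by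
  rw [map_add]
  refine (norm_add_le _ _).trans (add_le_add le_rfl ((norm_reL_le _).trans ?_))
  rw [norm_smul]

lemma diffContOnCl_line {G : Lp ℂ ⊤ m → X} {b ψ : Lp ℂ ⊤ m} {R : ℝ} (hR : 0 < R)
    (h : ∀ ζ : ℂ, ‖ζ‖ ≤ R → AnalyticAt ℂ G (b + ζ • ψ)) :
    DiffContOnCl ℂ (fun ζ : ℂ => G (b + ζ • ψ)) (Metric.ball 0 R) := by
  refine DifferentiableOn.diffContOnCl fun ζ hζ => ?_
  rw [closure_ball _ hR.ne', mem_closedBall_zero_iff] at hζ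
  exact (hasDerivAt_line (h ζ hζ)).differentiableAt.differentiableWithinAt

variable [CompleteSpace X]

/-- Cauchy's estimate on a small disc, at the price of a slightly wider strip. This stability makes
every mixed derivative square integrable, so that integration by parts can be iterated. -/
lemma IsStripHolomorphic.dirDeriv {G : Lp ℂ ⊤ m → X} (hG : IsStripHolomorphic G)
    (ψ : Lp ℂ ⊤ m) : IsStripHolomorphic (dirDeriv ψ G) := by
  refine ⟨fun b hb => ?_, fun s hs => ?_⟩
  · exact ((ContinuousLinearMap.apply ℂ X ψ).analyticAt _).comp (hG.analyticAt b hb).fderiv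
  · set s' := (s + Real.pi / 2) / 2 with hs'
    obtain ⟨C, hC0, hC⟩ := hG.growth s' (by linarith)
    -- Discs of this radius in direction ψ stay in the strip of width s', halfway to π/2; the +1
    -- covers ψ = 0.
    set R := (s' - s) / (‖ψ‖ + 1) with hRdef
    have hψ : 0 < ‖ψ‖ + 1 := by positivity
    have hR : 0 < R := div_pos (by linarith) hψ
    have hRψ : R * ‖ψ‖ ≤ s' - s := by
      rw [hRdef, div_mul_eq_mul_div, div_le_iff₀ hψ]
      nlinarith [norm_nonneg ψ]
    refine ⟨C * Real.exp (R * ‖ψ‖) / R, by positivity, fun b hb => ?_⟩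
    have him : ∀ ζ : ℂ, ‖ζ‖ ≤ R → ‖imL (b + ζ • ψ)‖ ≤ s' := fun ζ hζ => by
      have h1 := norm_imL_line_le b ψ ζ
      have h2 := mul_le_mul_of_nonneg_right hζ (norm_nonneg ψ)
      linarith
    have hd := Complex.norm_deriv_le_of_forall_mem_sphere_norm_le hR
      (diffContOnCl_line (b := b) (ψ := ψ) hR fun ζ hζ =>
        hG.analyticAt _ ((him ζ hζ).trans_lt (by linarith)))
      (C := C * Real.exp (‖reL b‖ + R * ‖ψ‖)) fun ζ hζ => by
        have hζ' : ‖ζ‖ ≤ R := by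
          rw [mem_sphere_zero_iff_norm] at hζ; exact hζ.le
        refine (hC _ (him ζ hζ')).trans (mul_le_mul_of_nonneg_left (Real.exp_le_exp.2 ?_) hC0)
        have h1 := norm_reL_line_le b ψ ζ
        have h2 := mul_le_mul_of_nonneg_right hζ' (norm_nonneg ψ)
        linarith
    have hb' : ‖imL (b + (0 : ℂ) • ψ)‖ < Real.pi / 2 :=
      (him 0 (by simpa using hR.le)).trans_lt (by linarith)
    rw [(hasDerivAt_line (hG.analyticAt _ hb')).deriv, zero_smul, add_zero] at hd
    refine hd.trans (le_of_eq ?_)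
    rw [Real.exp_add]; ring

lemma IsStripHolomorphic.iterate_dirDeriv {G : Lp ℂ ⊤ m → X} (hG : IsStripHolomorphic G)
    (ψ : Lp ℂ ⊤ m) (k : ℕ) : IsStripHolomorphic ((LogGaussian.dirDeriv ψ)^[k] G) := by
  induction k with
  | zero => exact hG
  | succ k ih =>
    rw [Function.iterate_succ_apply']
    exact ih.dirDeriv ψ

lemma iteratedDeriv_line {G : Lp ℂ ⊤ m → X} (hG : IsStripHolomorphic G) (b ψ : Lp ℂ ⊤ m)
    (k : ℕ) {ζ : ℂ} (hζ : ‖imL (b + ζ • ψ)‖ < Real.pi / 2) :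
    iteratedDeriv k (fun ζ : ℂ => G (b + ζ • ψ)) ζ = (dirDeriv ψ)^[k] G (b + ζ • ψ) := by
  induction k generalizing ζ with
  | zero => simp
  | succ k ih =>
    rw [iteratedDeriv_succ, Function.iterate_succ_apply']
    -- Openness of the strip turns the induction hypothesis into an identity near ζ, which can be
    -- differentiated.
    have hopen : IsOpen {ζ : ℂ | ‖imL (b + ζ • ψ)‖ < Real.pi / 2} :=
      isOpen_lt (by fun_prop) continuous_const
    have hev : iteratedDeriv k (fun ζ : ℂ => G (b + ζ • ψ)) =ᶠ[𝓝 ζ]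
        fun ζ => (dirDeriv ψ)^[k] G (b + ζ • ψ) :=
      Filter.mem_of_superset (hopen.mem_nhds hζ) fun z hz => ih hz
    rw [hev.deriv_eq]
    exact (hasDerivAt_line ((hG.iterate_dirDeriv ψ k).analyticAt _ hζ)).deriv

/-- Cauchy's estimate for an iterated directional derivative. -/
lemma norm_iterate_dirDeriv_le {G : Lp ℂ ⊤ m → X} (hG : IsStripHolomorphic G) {b ψ : Lp ℂ ⊤ m}
    (k : ℕ) {R C : ℝ} (hR : k ≠ 0 → 0 < R) (hR0 : 0 ≤ R)
    (hb : ∀ ζ : ℂ, ‖ζ‖ ≤ R → ‖imL (b + ζ • ψ)‖ < Real.pi / 2 ∧ ‖G (b + ζ • ψ)‖ ≤ C) :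
    ‖(dirDeriv ψ)^[k] G b‖ ≤ (k ! : ℝ) / R ^ k * C := by
  have hb0 := hb 0 (by simpa using hR0)
  -- For k = 0 the radius may be 0, so the bound is read off at the centre instead.
  rcases eq_or_ne k 0 with rfl | hk
  · simpa using hb0.2
  · have h := Complex.norm_iteratedDeriv_le_of_forall_mem_sphere_norm_le k (hR hk)
      (diffContOnCl_line (b := b) (ψ := ψ) (hR hk) fun ζ hζ => hG.analyticAt _ (hb ζ hζ).1)
      fun ζ hζ => (hb ζ (by rw [mem_sphere_zero_iff_norm] at hζ; exact hζ.le)).2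
    rw [iteratedDeriv_line hG b ψ k hb0.1, zero_smul, add_zero] at h
    exact h.trans (le_of_eq (by ring))

/-- The mixed derivative `∂^μ G` with respect to the first `n` directions. -/
def mixedDeriv (ψ : ℕ → Lp ℂ ⊤ m) (μ : ℕ → ℕ) (G : Lp ℂ ⊤ m → X) : ℕ → Lp ℂ ⊤ m → X
  | 0 => G
  | n + 1 => (dirDeriv (ψ n))^[μ n] (mixedDeriv ψ μ G n)

lemma IsStripHolomorphic.mixedDeriv {G : Lp ℂ ⊤ m → X} (hG : IsStripHolomorphic G)
    (ψ : ℕ → Lp ℂ ⊤ m) (μ : ℕ → ℕ) (n : ℕ) :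
    IsStripHolomorphic (LogGaussian.mixedDeriv ψ μ G n) := by
  induction n with
  | zero => exact hG
  | succ n ih => exact ih.iterate_dirDeriv (ψ n) (μ n)

/-- Cauchy's estimate for mixed derivatives on a polydisc. -/
lemma norm_mixedDeriv_le {G : Lp ℂ ⊤ m → X} (hG : IsStripHolomorphic G) (ψ : ℕ → Lp ℂ ⊤ m)
    (μ : ℕ → ℕ) {R : ℕ → ℝ} (hR0 : ∀ j, 0 ≤ R j) (hR : ∀ j, μ j ≠ 0 → R j ≠ 0) {C : ℝ} (n : ℕ)
    (b : Lp ℂ ⊤ m) (hb : ∀ z : ℕ → ℂ, (∀ j, ‖z j‖ ≤ R j) →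
      ‖imL (b + ∑ j ∈ Finset.range n, z j • ψ j)‖ < Real.pi / 2 ∧
        ‖G (b + ∑ j ∈ Finset.range n, z j • ψ j)‖ ≤ C) :
    ‖mixedDeriv ψ μ G n b‖ ≤ (∏ j ∈ Finset.range n, ((μ j)! : ℝ) / R j ^ μ j) * C := by
  induction n generalizing b with
  | zero =>
    have := (hb (fun _ => 0) (fun j => by simpa using hR0 j)).2
    simpa [mixedDeriv] using this
  | succ n ih =>
    rw [Finset.prod_range_succ, mul_comm (∏ j ∈ Finset.range n, _), mul_assoc]
    refine norm_iterate_dirDeriv_le (hG.mixedDeriv ψ μ n) (μ n)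
      (fun h => lt_of_le_of_ne (hR0 n) (hR n h).symm) (hR0 n) fun ζ hζ => ?_
    -- The last variable is absorbed into the centre, so the induction hypothesis applies at b +
    -- ζψ_n.
    have key : ∀ z : ℕ → ℂ, (∀ j, ‖z j‖ ≤ R j) →
        ‖imL (b + ζ • ψ n + ∑ j ∈ Finset.range n, z j • ψ j)‖ < Real.pi / 2 ∧
        ‖G (b + ζ • ψ n + ∑ j ∈ Finset.range n, z j • ψ j)‖ ≤ C := by
      intro z hz
      have h := hb (Function.update z n ζ) fun j => by
        rcases eq_or_ne j n with rfl | hj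
        · simpa using hζ
        · simpa [hj] using hz j
      have e : b + ∑ j ∈ Finset.range (n + 1), Function.update z n ζ j • ψ j =
          b + ζ • ψ n + ∑ j ∈ Finset.range n, z j • ψ j := by
        rw [Finset.sum_range_succ, Function.update_self, add_assoc, add_comm (ζ • ψ n)]
        congr 2
        refine Finset.sum_congr rfl fun j hj => ?_
        rw [Function.update_of_ne (Finset.mem_range.1 hj).ne]
      rwa [e] at h
    refine ⟨?_, ih _ key⟩
    have h := (key (fun _ => 0) fun j => by simpa using hR0 j).1
    simpa using h

lemma isStripHolomorphic_solveOp {E : Type*} [NormedAddCommGroup E] [InnerProductSpace ℂ E]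
    [CompleteSpace E] (K : Submodule ℂ (Lp E 2 m)) [CompleteSpace K] (F : K) :
    IsStripHolomorphic (solveOp K F) := by
  refine ⟨fun b hb => analyticAt_solveOp K F hb, fun s hs => ?_⟩
  by_cases h0 : 0 ≤ s
  · have hcos : 0 < Real.cos s := Real.cos_pos_of_mem_Ioo ⟨by linarith [Real.pi_pos], hs⟩
    refine ⟨‖F‖ / Real.cos s, by positivity, fun b hb => ?_⟩
    refine (norm_solveOp_le K F (hb.trans_lt hs)).trans ?_
    refine mul_le_mul_of_nonneg_right ?_ (Real.exp_pos _).le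
    refine div_le_div_of_nonneg_left (norm_nonneg _) hcos ?_
    exact Real.cos_le_cos_of_nonneg_of_le_pi (norm_nonneg _) (by linarith [Real.pi_pos]) hb
  · exact ⟨0, le_rfl, fun b hb => absurd ((norm_nonneg _).trans hb) h0⟩

end Derivatives

/-! ### Hermite coefficients of holomorphic functions of a Gaussian coefficient -/

section Coefficients

variable {Ω : Type*} [MeasurableSpace Ω] {m : Measure Ω}

lemma imL_toC_lt (b : Lp ℝ ⊤ m) : ‖imL (toC b)‖ < Real.pi / 2 := by
  rw [imL_toC, norm_zero]; positivity

lemma ofReal_smul_Lp (c : ℝ) (f : Lp ℂ ⊤ m) : (c : ℂ) • f = c • f := by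
  refine Lp.ext ?_
  filter_upwards [Lp.coeFn_smul c f, Lp.coeFn_smul (c : ℂ) f] with x h1 h2
  rw [h1, h2]
  simp

/-- `b` is an affine random coefficient with directions `ψ_j` and exponential moments. -/
structure IsGaussianCoeff (ψ : ℕ → Lp ℝ ⊤ m) (b : (ℕ → ℝ) → Lp ℝ ⊤ m) : Prop where
  aestronglyMeasurable : AEStronglyMeasurable b gaussian
  integrable_exp : Integrable (fun y => Real.exp ‖b y‖ ^ 2) gaussian
  update : ∀ᵐ y ∂gaussian, ∀ j t, b (Function.update y j t) = b y + (t - y j) • ψ j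

variable {ψ : ℕ → Lp ℝ ⊤ m} {b : (ℕ → ℝ) → Lp ℝ ⊤ m}

section Normed

variable {X : Type*} [NormedAddCommGroup X] [NormedSpace ℂ X]

lemma IsStripHolomorphic.continuous_toC {G : Lp ℂ ⊤ m → X} (hG : IsStripHolomorphic G) :
    Continuous fun a : Lp ℝ ⊤ m => G (toC a) :=
  continuous_iff_continuousAt.2 fun a =>
    ContinuousAt.comp (g := G) (hG.analyticAt _ (imL_toC_lt a)).continuousAt
      toC.continuous.continuousAt

lemma IsGaussianCoeff.memLp_exp (hb : IsGaussianCoeff ψ b) :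
    MemLp (fun y => Real.exp ‖b y‖) 2 gaussian :=
  (memLp_two_iff_integrable_sq
    (Real.continuous_exp.comp_aestronglyMeasurable hb.aestronglyMeasurable.norm)).2
    hb.integrable_exp

/-- Real coefficients have zero imaginary part, so the growth bound for s = 0 and the second
exponential moment suffice. -/
lemma IsGaussianCoeff.memLp (hb : IsGaussianCoeff ψ b) {G : Lp ℂ ⊤ m → X}
    (hG : IsStripHolomorphic G) : MemLp (fun y => G (toC (b y))) 2 gaussian := by
  obtain ⟨C, hC0, hC⟩ := hG.growth 0 (by positivity)
  refine (hb.memLp_exp.const_mul C).mono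
    (hG.continuous_toC.comp_aestronglyMeasurable hb.aestronglyMeasurable)
    (ae_of_all _ fun y => ?_)
  have h := hC (toC (b y)) (by rw [imL_toC, norm_zero])
  rw [reL_toC] at h
  exact h.trans (le_abs_self _)

variable [CompleteSpace X]

lemma IsGaussianCoeff.hermiteCoeff_dirDeriv (hb : IsGaussianCoeff ψ b) {G : Lp ℂ ⊤ m → X}
    (hG : IsStripHolomorphic G) (j : ℕ) (α : ℕ →₀ ℕ) :
    hermiteCoeff (fun y => dirDeriv (toC (ψ j)) G (toC (b y))) α =
      √((α j : ℝ) + 1) • hermiteCoeff (fun y => G (toC (b y))) (α + Finsupp.single j 1) := by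
  refine hermiteCoeff_deriv (hb.memLp hG) (hb.memLp (hG.dirDeriv _)) j ?_ α
  filter_upwards [hb.update] with y hy t
  have e : ∀ t, toC (b (Function.update y j t)) =
      toC (b y) + ((t - y j : ℝ) : ℂ) • toC (ψ j) := fun t => by
    rw [hy, map_add, map_smul, ofReal_smul_Lp]
  simp only [e]
  refine hasDerivAt_real_line (hG.analyticAt _ ?_)
  rw [← e]
  exact imL_toC_lt _

/-- The k shifts contribute (α_j+1)⋯(α_j+k) = k! binom(α_j+k, k). -/
lemma IsGaussianCoeff.norm_hermiteCoeff_iterate (hb : IsGaussianCoeff ψ b) {G : Lp ℂ ⊤ m → X}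
    (hG : IsStripHolomorphic G) (j k : ℕ) (α : ℕ →₀ ℕ) :
    ‖hermiteCoeff (fun y => (dirDeriv (toC (ψ j)))^[k] G (toC (b y))) α‖ ^ 2 =
      ((k ! : ℝ) * ((α j + k).choose k : ℝ)) *
        ‖hermiteCoeff (fun y => G (toC (b y))) (α + Finsupp.single j k)‖ ^ 2 := by
  induction k generalizing α with
  | zero => simp
  | succ k ih =>
    rw [Function.iterate_succ_apply', hb.hermiteCoeff_dirDeriv (hG.iterate_dirDeriv _ k),
      norm_smul, mul_pow, ih, Real.norm_of_nonneg (Real.sqrt_nonneg _),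
      Real.sq_sqrt (by positivity), add_assoc, ← Finsupp.single_add, add_comm 1 k, ← mul_assoc]
    congr 1
    have h := Nat.choose_succ_right_eq (α j + (k + 1)) k
    have h2 : α j + (k + 1) - k = α j + 1 := by omega
    rw [h2] at h
    have h3 : ((α j + (k + 1)).choose (k + 1) : ℝ) * ((k : ℝ) + 1) =
        ((α j + (k + 1)).choose k : ℝ) * ((α j : ℝ) + 1) := by exact_mod_cast h
    have h4 : (α + Finsupp.single j 1 : ℕ →₀ ℕ) j + k = α j + (k + 1) := by
      rw [Finsupp.add_apply, Finsupp.single_eq_same]; ring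
    rw [h4, Nat.factorial_succ]
    push_cast
    linear_combination (-(k ! : ℝ)) * h3

lemma IsGaussianCoeff.norm_hermiteCoeff_mixedDeriv (hb : IsGaussianCoeff ψ b)
    {G : Lp ℂ ⊤ m → X} (hG : IsStripHolomorphic G) (μ : ℕ → ℕ) (n : ℕ) (α : ℕ →₀ ℕ) :
    ‖hermiteCoeff (fun y => mixedDeriv (fun j => toC (ψ j)) μ G n (toC (b y))) α‖ ^ 2 =
      (∏ j ∈ Finset.range n, (((μ j)! : ℝ) * ((α j + μ j).choose (μ j) : ℝ))) *
        ‖hermiteCoeff (fun y => G (toC (b y)))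
          (α + ∑ j ∈ Finset.range n, Finsupp.single j (μ j))‖ ^ 2 := by
  induction n generalizing α with
  | zero => simp [mixedDeriv]
  | succ n ih =>
    have h := hb.norm_hermiteCoeff_iterate
      (hG.mixedDeriv (fun j => toC (ψ j)) μ n) n (μ n) α
    rw [ih] at h
    refine h.trans ?_
    rw [Finset.prod_range_succ, Finset.sum_range_succ, ← mul_assoc,
      mul_comm (_ * _) (∏ j ∈ Finset.range n, _), add_assoc, add_comm (Finsupp.single n (μ n))]
    congr 2
    refine Finset.prod_congr rfl fun j hj => ?_
    have : (α + Finsupp.single n (μ n)) j = α j := by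
      simp [(Finset.mem_range.1 hj).ne]
    rw [this]

end Normed

lemma coeFn_polydisc (a : Lp ℝ ⊤ m) (ψ : ℕ → Lp ℝ ⊤ m) (z : ℕ → ℂ) (n : ℕ) :
    (toC a + ∑ j ∈ Finset.range n, z j • toC (ψ j) : Lp ℂ ⊤ m) =ᵐ[m]
      fun x => (a x : ℂ) + ∑ j ∈ Finset.range n, z j * (ψ j x : ℂ) := by
  induction n with
  | zero => simpa using coeFn_toC a
  | succ n ih =>
    rw [Finset.sum_range_succ, ← add_assoc]
    filter_upwards [ih, Lp.coeFn_add (toC a + ∑ j ∈ Finset.range n, z j • toC (ψ j))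
      (z n • toC (ψ n)), Lp.coeFn_smul (z n) (toC (ψ n)), coeFn_toC (ψ n)] with x h1 h2 h3 h4
    rw [h2, Pi.add_apply, h1, h3, Pi.smul_apply, h4, Finset.sum_range_succ, smul_eq_mul, add_assoc]

/-- The centre is real, so only the perturbation, pointwise at most κ in modulus, contributes to the
imaginary part. -/
lemma norm_polydisc_le (a : Lp ℝ ⊤ m) {R : ℕ → ℝ} {κ : ℝ} (hκ0 : 0 ≤ κ)
    (hκ : ∀ᵐ x ∂m, ∀ n, ∑ j ∈ Finset.range n, R j * |ψ j x| ≤ κ) {z : ℕ → ℂ}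
    (hz : ∀ j, ‖z j‖ ≤ R j) (n : ℕ) :
    ‖imL (toC a + ∑ j ∈ Finset.range n, z j • toC (ψ j))‖ ≤ κ ∧
      ‖reL (toC a + ∑ j ∈ Finset.range n, z j • toC (ψ j))‖ ≤ ‖a‖ + κ := by
  have hsum : ∀ᵐ x ∂m, ‖∑ j ∈ Finset.range n, z j * (ψ j x : ℂ)‖ ≤ κ := by
    filter_upwards [hκ] with x hx
    refine (norm_sum_le _ _).trans (le_trans (Finset.sum_le_sum fun j _ => ?_) (hx n))
    rw [norm_mul, Complex.norm_real, Real.norm_eq_abs]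
    exact mul_le_mul_of_nonneg_right (hz j) (abs_nonneg _)
  constructor
  · refine Lp.norm_le_of_ae hκ0 ?_
    filter_upwards [coeFn_imL (toC a + ∑ j ∈ Finset.range n, z j • toC (ψ j)),
      coeFn_polydisc a ψ z n, hsum] with x h1 h2 h3
    rw [h1, h2, Complex.add_im, Complex.ofReal_im, zero_add]
    exact (Complex.abs_im_le_norm _).trans h3
  · refine Lp.norm_le_of_ae (by positivity) ?_
    filter_upwards [coeFn_reL (toC a + ∑ j ∈ Finset.range n, z j • toC (ψ j)),
      coeFn_polydisc a ψ z n, hsum, Lp.ae_norm_le a] with x h1 h2 h3 h4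
    rw [h1, h2, Complex.add_re, Complex.ofReal_re]
    exact (norm_add_le _ _).trans (add_le_add h4 ((Complex.abs_re_le_norm _).trans h3))

variable {X : Type*} [NormedAddCommGroup X] [InnerProductSpace ℂ X] [CompleteSpace X]

lemma multiPow_two_smul_eq_sq (c : ℕ → ℝ) (μ : ℕ →₀ ℕ) :
    multiPow c (2 • μ) = (multiPow c μ) ^ 2 := by
  rw [multiPow_two_smul, multiPow, Finsupp.prod, Finsupp.prod, ← Finset.prod_pow]
  exact Finset.prod_congr rfl fun j _ => by rw [← pow_mul, mul_comm]

/-- The Hermite coefficients weighted by multinomial coefficients are controlled by the radii of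
the polydiscs of holomorphy. -/
lemma IsGaussianCoeff.sum_multiChoose_le (hb : IsGaussianCoeff ψ b) {G : Lp ℂ ⊤ m → X}
    (hG : IsStripHolomorphic G) {κ : ℝ} (hκ0 : 0 ≤ κ) (hκπ : κ < Real.pi / 2) {C : ℝ}
    (hC0 : 0 ≤ C) (hC : ∀ a, ‖imL a‖ ≤ κ → ‖G a‖ ≤ C * Real.exp ‖reL a‖) (μ : ℕ →₀ ℕ)
    {R : ℕ → ℝ} (hR0 : ∀ j, 0 ≤ R j) (hR : ∀ j, μ j ≠ 0 → R j ≠ 0)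
    (hκ : ∀ᵐ x ∂m, ∀ n, ∑ j ∈ Finset.range n, R j * |ψ j x| ≤ κ) (T : Finset (ℕ →₀ ℕ)) :
    ∑ α ∈ T, multiChoose (α + μ) μ * ‖hermiteCoeff (fun y => G (toC (b y))) (α + μ)‖ ^ 2 ≤
      multiFactorial μ / multiPow R (2 • μ) *
        ((C * Real.exp κ) ^ 2 * ∫ y, Real.exp ‖b y‖ ^ 2 ∂gaussian) := by
  obtain ⟨n, hn⟩ : ∃ n, μ.support ⊆ Finset.range n := μ.support.exists_nat_subset_range
  have hμ : ∑ j ∈ Finset.range n, Finsupp.single j (μ j) = μ := by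
    conv_rhs => rw [← μ.sum_single]
    exact (Finsupp.sum_of_support_subset _ hn _ fun _ _ => Finsupp.single_zero _).symm
  set M := fun y => mixedDeriv (fun j => toC (ψ j)) μ G n (toC (b y)) with hM
  have hMmem : MemLp M 2 gaussian := hb.memLp (hG.mixedDeriv _ _ _)
  have hfac : 0 < multiFactorial μ := Finset.prod_pos fun j _ => by positivity
  have hpow : 0 < multiPow R μ := Finset.prod_pos fun j hj =>
    pow_pos (lt_of_le_of_ne (hR0 j) (hR j (Finsupp.mem_support_iff.1 hj)).symm) _
  have hprod : (∏ j ∈ Finset.range n, ((μ j)! : ℝ) / R j ^ μ j) =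
      multiFactorial μ / multiPow R μ := by
    rw [Finset.prod_div_distrib, multiFactorial, multiPow,
      Finsupp.prod_of_support_subset _ hn _ fun _ _ => by simp,
      Finsupp.prod_of_support_subset _ hn _ fun _ _ => by simp]
  -- Cauchy on the polydisc of radii R about b(y); leaving the centre costs the factor exp κ.
  have hbound : ∀ y, ‖M y‖ ≤ multiFactorial μ / multiPow R μ *
      (C * Real.exp κ * Real.exp ‖b y‖) := by
    intro y
    rw [← hprod]
    refine norm_mixedDeriv_le hG _ μ hR0 hR n _ fun z hz => ?_
    have h := norm_polydisc_le (b y) hκ0 hκ hz n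
    refine ⟨h.1.trans_lt hκπ, (hC _ h.1).trans ?_⟩
    rw [mul_assoc, ← Real.exp_add, add_comm κ]
    exact mul_le_mul_of_nonneg_left (Real.exp_le_exp.2 h.2) hC0
  have hint : ∫ y, ‖M y‖ ^ 2 ∂gaussian ≤ (multiFactorial μ / multiPow R μ) ^ 2 *
      ((C * Real.exp κ) ^ 2 * ∫ y, Real.exp ‖b y‖ ^ 2 ∂gaussian) := by
    rw [← integral_const_mul, ← integral_const_mul]
    refine integral_mono (by simpa using hMmem.integrable_norm_pow (by norm_num))
      ((hb.integrable_exp.const_mul _).const_mul _) fun y => ?_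
    refine (pow_le_pow_left₀ (norm_nonneg _) (hbound y) 2).trans (le_of_eq ?_)
    ring
  have hcoef : ∀ α, ‖hermiteCoeff M α‖ ^ 2 = multiFactorial μ *
      (multiChoose (α + μ) μ * ‖hermiteCoeff (fun y => G (toC (b y))) (α + μ)‖ ^ 2) := by
    intro α
    rw [hM, hb.norm_hermiteCoeff_mixedDeriv hG μ n α, hμ, Finset.prod_mul_distrib, ← mul_assoc,
      multiFactorial, multiChoose, Finsupp.prod_of_support_subset μ hn _ fun _ _ => by simp,
      Finsupp.prod_of_support_subset μ hn _ fun _ _ => by simp]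
    rfl
  let _ : InnerProductSpace ℝ X := InnerProductSpace.complexToReal
  have hbessel := (sum_norm_hermiteCoeff_sq_le hMmem T).trans hint
  simp only [hcoef, ← Finset.mul_sum] at hbessel
  rw [multiPow_two_smul_eq_sq]
  -- Bessel gives μ! on the left against (μ!)² on the right; cancelling leaves a single factorial.
  refine le_of_mul_le_mul_left (hbessel.trans (le_of_eq ?_)) hfac
  field_simp

end Coefficients

/-! ### The Poincaré inequality and the weak formulation -/

lemma Lp.norm_sq_eq_integral {Ω E : Type*} [MeasurableSpace Ω] {m : Measure Ω}
    [NormedAddCommGroup E] [InnerProductSpace ℝ E] (h : Lp E 2 m) :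
    ‖h‖ ^ 2 = ∫ x, ‖h x‖ ^ 2 ∂m := by
  rw [← real_inner_self_eq_norm_sq h, L2.inner_def]
  exact integral_congr_ae (ae_of_all _ fun x => real_inner_self_eq_norm_sq (h x))

lemma norm_fderiv_apply_le_gradient {d : ℕ} (η : Space d → ℝ) (x v : Space d) :
    |fderiv ℝ η x v| ≤ ‖∇ η x‖ * ‖v‖ := by
  have : ‖∇ η x‖ = ‖fderiv ℝ η x‖ := by
    simp [gradient]
  rw [this]
  exact (fderiv ℝ η x).le_opNorm v

lemma fderiv_sq_apply {E : Type*} [NormedAddCommGroup E] [NormedSpace ℝ E] {η : E → ℝ} {x : E}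
    (h : DifferentiableAt ℝ η x) (v : E) :
    fderiv ℝ (fun x => η x ^ 2) x v = 2 * η x * fderiv ℝ η x v := by
  have h2 := (hasDerivAt_pow 2 (η x)).comp_hasFDerivAt x h.hasFDerivAt
  have h3 : fderiv ℝ (fun x => η x ^ 2) x = _ := h2.fderiv
  rw [h3]
  simp

/-- The Poincaré inequality for test functions. -/
lemma integral_sq_le_integral_gradient {d : ℕ} (hd : 1 ≤ d) {D : Set (Space d)} {R : ℝ}
    (hDR : ∀ x ∈ D, ‖x‖ ≤ R) {η : Space d → ℝ} (hη : ContDiff ℝ ∞ η)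
    (hc : HasCompactSupport η) (hs : tsupport η ⊆ D) :
    ∫ x, η x ^ 2 ≤ 4 * R ^ 2 * ∫ x, ‖∇ η x‖ ^ 2 := by
  obtain ⟨e, he⟩ : ∃ e : Space d, ‖e‖ = 1 := ⟨EuclideanSpace.single ⟨0, hd⟩ 1, by simp⟩
  -- The coordinate l along e has derivative 1 in direction e and is bounded by R on D, so ∫ η² = ∫
  -- η² ∂_e l can be integrated by parts.
  obtain ⟨l, hle, hlx⟩ : ∃ l : Space d →L[ℝ] ℝ, l e = 1 ∧ ∀ x, |l x| ≤ ‖x‖ := by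
    refine ⟨innerSL ℝ e, by simp [he], fun x => ?_⟩
    have := norm_inner_le_norm (𝕜 := ℝ) e x
    rw [he, one_mul] at this
    exact this
  have hdiff : Differentiable ℝ η := hη.differentiable (by simp)
  have hηc : Continuous η := hη.continuous
  have hfc : Continuous (fderiv ℝ η) := hη.continuous_fderiv (by simp)
  have hgc : Continuous (∇ η) :=
    ((InnerProductSpace.toDual ℝ (Space d)).symm.continuous).comp hfc
  have hgs : HasCompactSupport (∇ η) :=
    (hc.fderiv ℝ).comp_left (g := (InnerProductSpace.toDual ℝ (Space d)).symm) (map_zero _)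
  have hfd : ∀ x, fderiv ℝ (fun x => η x ^ 2) x e = 2 * η x * fderiv ℝ η x e :=
    fun x => fderiv_sq_apply (hdiff x) e
  have hc2 : HasCompactSupport fun x => η x ^ 2 :=
    hc.mono fun x hx h => hx (by simp only [h]; norm_num)
  have hg2 : HasCompactSupport fun x => ‖∇ η x‖ ^ 2 :=
    hgs.mono fun x hx h => hx (by simp only [h]; norm_num)
  have i1 : Integrable (fun x => η x ^ 2) := by
    refine Continuous.integrable_of_hasCompactSupport ?_ hc2
    exact hηc.pow 2
  have i2 : Integrable (fun x => ‖∇ η x‖ ^ 2) := by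
    refine Continuous.integrable_of_hasCompactSupport ?_ hg2
    exact hgc.norm.pow 2
  have i3 : Integrable (fun x => fderiv ℝ (fun x => η x ^ 2) x e * l x) := by
    simp only [hfd]
    refine Continuous.integrable_of_hasCompactSupport
      (((continuous_const.mul hηc).mul (hfc.clm_apply continuous_const)).mul l.continuous) ?_
    exact ((hc.mul_left (f := fun _ => (2 : ℝ))).mul_right).mul_right
  have i4 : Integrable (fun x => η x ^ 2 * l x) := by
    refine Continuous.integrable_of_hasCompactSupport ((hηc.pow 2).mul l.continuous) ?_
    exact hc2.mul_right
  have hibp := integral_mul_fderiv_eq_neg_fderiv_mul_of_integrable (μ := volume)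
    (f := fun x => η x ^ 2) (g := l) (v := e) i3
    (by simpa [hle] using i1) i4 (fun x _ => (hdiff x).pow 2) (fun x _ => l.differentiableAt)
  simp only [l.fderiv, hle, mul_one] at hibp
  rw [← integral_neg] at hibp
  -- Young's inequality with weight 1/2 on η², so that this term can be absorbed on the left; this
  -- produces the constant 4R².
  have hpt : ∀ x, -(fderiv ℝ (fun x => η x ^ 2) x e * l x) ≤
      (1 / 2) * η x ^ 2 + 2 * R ^ 2 * ‖∇ η x‖ ^ 2 := by
    intro x
    rw [hfd]
    by_cases hx : x ∈ D
    · have h1 : |fderiv ℝ η x e| ≤ ‖∇ η x‖ := by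
        simpa [he] using norm_fderiv_apply_le_gradient η x e
      have h2 : |l x| ≤ R := (hlx x).trans (hDR x hx)
      have h3 : |fderiv ℝ η x e * l x| ≤ ‖∇ η x‖ * R := by
        rw [abs_mul]
        exact mul_le_mul h1 h2 (abs_nonneg _) (norm_nonneg _)
      have h4 : (fderiv ℝ η x e * l x) ^ 2 ≤ (‖∇ η x‖ * R) ^ 2 :=
        sq_le_sq' (by linarith [neg_abs_le (fderiv ℝ η x e * l x)])
          ((le_abs_self _).trans h3)
      nlinarith [sq_nonneg (η x + 2 * (fderiv ℝ η x e * l x))]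
    · have : η x = 0 := by
        by_contra hne
        exact hx (hs (subset_tsupport η hne))
      rw [this]
      simp
      positivity
  have hmono : ∫ x, -(fderiv ℝ (fun x => η x ^ 2) x e * l x) ≤
      ∫ x, ((1 / 2) * η x ^ 2 + 2 * R ^ 2 * ‖∇ η x‖ ^ 2) :=
    integral_mono i3.neg ((i1.const_mul (1 / 2)).add (i2.const_mul (2 * R ^ 2))) hpt
  rw [← hibp, integral_add (i1.const_mul _) (i2.const_mul _), integral_const_mul,
    integral_const_mul] at hmono
  linarith

/-- The Poincaré inequality on `H¹₀(D)` for a bounded set `D`. -/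
lemma exists_norm_fst_le {d : ℕ} (hd : 1 ≤ d) {D : Set (Space d)}
    (hDb : Bornology.IsBounded D) :
    ∃ C : ℝ, 0 ≤ C ∧ ∀ v : H10 D, ‖(v : L2Pair D).fst‖ ≤ C * ‖grad v‖ := by
  obtain ⟨R, hR0, hR⟩ := hDb.exists_pos_norm_le
  refine ⟨2 * R, by positivity, ?_⟩
  -- The inequality is a closed condition, so it passes from test functions to their closure.
  have hclosed : IsClosed {p : L2Pair D | ‖p.fst‖ ≤ 2 * R * ‖p.snd‖} :=
    isClosed_le (WithLp.fstL 2 ℝ _ _).continuous.norm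
      ((WithLp.sndL 2 ℝ _ _).continuous.norm.const_mul _)
  have hsub : ((testPairs D : Submodule ℝ (L2Pair D)) : Set (L2Pair D)) ⊆
      {p : L2Pair D | ‖p.fst‖ ≤ 2 * R * ‖p.snd‖} := by
    rintro p ⟨η, hη, hc, hs, h1, h2⟩
    have e1 : ‖p.fst‖ ^ 2 = ∫ x, η x ^ 2 := by
      rw [Lp.norm_sq_eq_integral]
      refine Eq.trans (integral_congr_ae ?_)
        (setIntegral_eq_integral_of_forall_compl_eq_zero (s := D) fun x hx => ?_)
      · filter_upwards [h1] with x hx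
        rw [hx, Real.norm_eq_abs, sq_abs]
      · have : η x = 0 := by
          by_contra hne
          exact hx (hs (subset_tsupport η hne))
        rw [this]; simp
    have e2 : ‖p.snd‖ ^ 2 = ∫ x, ‖∇ η x‖ ^ 2 := by
      rw [Lp.norm_sq_eq_integral]
      refine Eq.trans (integral_congr_ae ?_)
        (setIntegral_eq_integral_of_forall_compl_eq_zero (s := D) fun x hx => ?_)
      · filter_upwards [h2] with x hx
        rw [hx]
      · have : fderiv ℝ η x = 0 := by
          by_contra hne
          have hmem : x ∈ Function.support (fderiv ℝ η) := hne
          exact hx (hs (support_fderiv_subset (𝕜 := ℝ) (f := η) hmem))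
        simp [gradient, this]
    have hP := integral_sq_le_integral_gradient hd hR hη hc hs
    rw [← e1, ← e2] at hP
    refine (sq_le_sq₀ (norm_nonneg _) (by positivity)).1 ?_
    calc ‖p.fst‖ ^ 2 ≤ 4 * R ^ 2 * ‖p.snd‖ ^ 2 := hP
      _ = (2 * R * ‖p.snd‖) ^ 2 := by ring
  exact fun v => closure_minimal hsub hclosed v.2

lemma exists_norm_le_normV {d : ℕ} (hd : 1 ≤ d) {D : Set (Space d)}
    (hDb : Bornology.IsBounded D) :
    ∃ C : ℝ, 0 < C ∧ ∀ v : H10 D, ‖v‖ ≤ C * ‖grad v‖ := by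
  obtain ⟨C, hC0, hC⟩ := exists_norm_fst_le hd hDb
  refine ⟨C + 1, by positivity, fun v => ?_⟩
  have h := WithLp.prod_norm_sq_eq_of_L2 (v : L2Pair D)
  refine (sq_le_sq₀ (norm_nonneg _) (by positivity)).1 ?_
  have h1 : ‖v‖ ^ 2 = ‖(v : L2Pair D).fst‖ ^ 2 + ‖grad v‖ ^ 2 := h
  have h2 := pow_le_pow_left₀ (norm_nonneg _) (hC v) 2
  rw [h1]
  nlinarith [mul_nonneg hC0 (sq_nonneg ‖grad v‖)]

/-- The weak gradient as a continuous linear map. -/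
def gradL {d : ℕ} (D : Set (Space d)) : H10 D →L[ℝ] Lp (Space d) 2 (volume.restrict D) :=
  (WithLp.sndL 2 ℝ _ _) ∘L (H10 D).subtypeL

section RealForm

variable {Ω : Type*} [MeasurableSpace Ω] {m : Measure Ω}

lemma memLp_exp_top (b : Lp ℝ ⊤ m) : MemLp (fun x => Real.exp (b x)) ⊤ m := by
  refine memLp_top_of_bound
    (Real.continuous_exp.comp_aestronglyMeasurable (Lp.aestronglyMeasurable b))
    (Real.exp ‖b‖) ?_
  filter_upwards [Lp.ae_norm_le b] with x hx
  rw [Real.norm_of_nonneg (Real.exp_pos _).le]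
  exact Real.exp_le_exp.2 ((le_abs_self _).trans hx)

variable {E : Type*} [NormedAddCommGroup E] [InnerProductSpace ℝ E]

variable (E) in
/-- Multiplication by `exp b` on real `L²`. -/
def expMul (b : Lp ℝ ⊤ m) : Lp E 2 m →L[ℝ] Lp E 2 m :=
  (ContinuousLinearMap.lsmul ℝ ℝ).holderL m ⊤ 2 2 (memLp_exp_top b).toLp

lemma coeFn_expMul (b : Lp ℝ ⊤ m) (h : Lp E 2 m) :
    expMul E b h =ᵐ[m] fun x => Real.exp (b x) • h x := by
  unfold expMul
  rw [ContinuousLinearMap.holderL_apply_apply]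
  filter_upwards [ContinuousLinearMap.coeFn_holder (r := 2) (ContinuousLinearMap.lsmul ℝ ℝ (E := E))
    (memLp_exp_top b).toLp h, (memLp_exp_top b).coeFn_toLp] with x h1 h2
  rw [h1, h2]; rfl

lemma inner_expMul (b : Lp ℝ ⊤ m) (g h : Lp E 2 m) :
    inner ℝ (expMul E b g) h = ∫ x, Real.exp (b x) * inner ℝ (g x) (h x) ∂m := by
  rw [L2.inner_def]
  refine integral_congr_ae ?_
  filter_upwards [coeFn_expMul b g] with x hx
  rw [hx, inner_smul_left]; rfl

lemma inner_expMul_self_ge (b : Lp ℝ ⊤ m) (h : Lp E 2 m) :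
    Real.exp (-‖b‖) * ‖h‖ ^ 2 ≤ inner ℝ (expMul E b h) h := by
  have i1 : Integrable (fun x => ‖h x‖ ^ 2) m := by
    simpa using (Lp.memLp h).integrable_norm_pow (by norm_num)
  rw [Lp.norm_sq_eq_integral, L2.inner_def, ← integral_const_mul]
  refine integral_mono_ae (i1.const_mul _) (L2.integrable_inner _ _) ?_
  filter_upwards [Lp.ae_norm_le b, coeFn_expMul b h] with x h1 h2
  rw [h2, inner_smul_left, real_inner_self_eq_norm_sq]
  refine mul_le_mul_of_nonneg_right (Real.exp_le_exp.2 ?_) (by positivity)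
  exact (neg_le_neg h1).trans (neg_abs_le _)

end RealForm

/-- Existence and uniqueness of weak solutions. -/
lemma existsUnique_isWeakSolution {d : ℕ} (hd : 1 ≤ d) {D : Set (Space d)}
    (hDb : Bornology.IsBounded D) (b : LInf D) (f : H10 D →L[ℝ] ℝ) :
    ∃! u : H10 D, IsWeakSolution b f u := by
  obtain ⟨C, hC0, hC⟩ := exists_norm_le_normV hd hDb
  obtain ⟨T, hTi⟩ : ∃ T : H10 D →L[ℝ] H10 D, ∀ u v : H10 D, inner ℝ (T u) v =
      ∫ x in D, Real.exp (b x) * inner ℝ (grad u x) (grad v x) := by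
    refine ⟨ContinuousLinearMap.adjoint (gradL D) ∘L expMul (Space d) b ∘L gradL D,
      fun u v => ?_⟩
    rw [ContinuousLinearMap.comp_apply, ContinuousLinearMap.adjoint_inner_left,
      ContinuousLinearMap.comp_apply, inner_expMul]
    rfl
  -- Coercivity constant in the full H¹ norm; C² is the price of the Poincaré inequality.
  have hc : 0 < Real.exp (-‖b‖) / C ^ 2 := by positivity
  have hunit : IsUnit T := by
    refine ContinuousLinearMap.isUnit_of_forall_le_norm_inner_map T
      (c := ⟨Real.exp (-‖b‖) / C ^ 2, hc.le⟩) hc fun v => ?_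
    have h1 : inner ℝ (T v) v = inner ℝ (expMul (Space d) b (grad v)) (grad v) := by
      rw [hTi, inner_expMul]
    rw [h1]
    refine le_trans ?_ (le_abs_self _)
    refine le_trans ?_ (inner_expMul_self_ge b (grad v))
    have h2 := pow_le_pow_left₀ (norm_nonneg _) (hC v) 2
    change ‖v‖ ^ 2 * (Real.exp (-‖b‖) / C ^ 2) ≤ _
    rw [mul_div_assoc', div_le_iff₀ (by positivity)]
    nlinarith [Real.exp_pos (-‖b‖)]
  obtain ⟨F, hF⟩ : ∃ F : H10 D, ∀ v, inner ℝ F v = f v :=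
    ⟨(InnerProductSpace.toDual ℝ (H10 D)).symm f, fun v => InnerProductSpace.toDual_symm_apply⟩
  have hiff : ∀ u, IsWeakSolution b f u ↔ T u = F := by
    intro u
    constructor
    · intro h
      refine ext_inner_right ℝ fun v => ?_
      rw [hTi, hF]
      exact h v
    · intro h v
      rw [← hTi, h, hF]
  have hbij := ContinuousLinearMap.isUnit_iff_bijective.1 hunit
  obtain ⟨u, hu, huniq⟩ := hbij.existsUnique F
  exact ⟨u, (hiff u).2 hu, fun w hw => huniq w ((hiff w).1 hw)⟩

/-! ### Complexification of gradient fields -/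

/-- The inclusion of `ℝ^d` into `ℂ^d`. -/
def complexifyVec (d : ℕ) : Space d →L[ℝ] EuclideanSpace ℂ (Fin d) :=
  LinearMap.toContinuousLinearMap
    { toFun := fun x => WithLp.toLp 2 fun i => (x i : ℂ)
      map_add' := fun x y => by ext i; simp
      map_smul' := fun c x => by ext i; simp }

lemma complexifyVec_apply {d : ℕ} (x : Space d) (i : Fin d) :
    complexifyVec d x i = (x i : ℂ) := rfl

lemma inner_complexifyVec {d : ℕ} (x y : Space d) :
    inner ℂ (complexifyVec d x) (complexifyVec d y) = ((inner ℝ x y : ℝ) : ℂ) := by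
  simp [PiLp.inner_apply, complexifyVec_apply]

lemma norm_complexifyVec {d : ℕ} (x : Space d) : ‖complexifyVec d x‖ = ‖x‖ := by
  simp [EuclideanSpace.norm_eq, complexifyVec_apply]

/-- The gradient of `v ∈ H¹₀(D)` as a complex vector field. -/
def cgrad {d : ℕ} (D : Set (Space d)) :
    H10 D →L[ℝ] Lp (EuclideanSpace ℂ (Fin d)) 2 (volume.restrict D) :=
  ((complexifyVec d).compLpL 2 (volume.restrict D)) ∘L gradL D

lemma coeFn_cgrad {d : ℕ} {D : Set (Space d)} (v : H10 D) :
    cgrad D v =ᵐ[volume.restrict D] fun x => complexifyVec d (grad v x) :=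
  (complexifyVec d).coeFn_compLpL (grad v)

lemma norm_cgrad {d : ℕ} {D : Set (Space d)} (v : H10 D) : ‖cgrad D v‖ = normV v := by
  rw [normV, Lp.norm_def, Lp.norm_def]
  congr 1
  refine eLpNorm_congr_norm_ae ?_
  filter_upwards [coeFn_cgrad v] with x hx
  rw [hx, norm_complexifyVec]

/-- The closed complex subspace spanned by the gradients of `H¹₀(D)`. -/
def gradSpace {d : ℕ} (D : Set (Space d)) :
    Submodule ℂ (Lp (EuclideanSpace ℂ (Fin d)) 2 (volume.restrict D)) :=
  (Submodule.span ℂ (Set.range (cgrad D))).topologicalClosure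

instance completeSpace_gradSpace {d : ℕ} (D : Set (Space d)) : CompleteSpace (gradSpace D) := by
  unfold gradSpace; infer_instance

lemma cgrad_mem {d : ℕ} {D : Set (Space d)} (v : H10 D) : cgrad D v ∈ gradSpace D :=
  Submodule.le_topologicalClosure _ (Submodule.subset_span ⟨v, rfl⟩)

lemma inner_exp_mulOp_cgrad {d : ℕ} {D : Set (Space d)} (b : LInf D) (u v : H10 D) :
    inner ℂ (NormedSpace.exp (mulOp (volume.restrict D) (EuclideanSpace ℂ (Fin d)) (toC b))
      (cgrad D u)) (cgrad D v) =
      ((∫ x in D, Real.exp (b x) * inner ℝ (grad u x) (grad v x) : ℝ) : ℂ) := by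
  rw [L2.inner_def]
  refine Eq.trans (integral_congr_ae ?_) (integral_ofReal (𝕜 := ℂ))
  filter_upwards [coeFn_exp_mulOp (toC b) (cgrad D u), coeFn_cgrad u, coeFn_cgrad v, coeFn_toC b]
    with x h1 h2 h3 h4
  rw [h1, h2, h3, h4, inner_smul_left, inner_complexifyVec, ← Complex.ofReal_exp,
    Complex.conj_ofReal]
  exact (Complex.ofReal_mul _ _).symm

/-- The complex solution operator extends the real one. -/
lemma cgrad_eq_solveOp {d : ℕ} {D : Set (Space d)} {f : H10 D →L[ℝ] ℝ} {u₀ u : H10 D}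
    {b : LInf D} (h₀ : IsWeakSolution 0 f u₀) (h : IsWeakSolution b f u) :
    cgrad D u = (solveOp (gradSpace D) ⟨cgrad D u₀, cgrad_mem u₀⟩ (toC b) :
      Lp (EuclideanSpace ℂ (Fin d)) 2 (volume.restrict D)) := by
  have hform : formOp (gradSpace D) (toC b) ⟨cgrad D u, cgrad_mem u⟩ =
      ⟨cgrad D u₀, cgrad_mem u₀⟩ := by
    refine ext_inner_right ℂ fun k => ?_
    rw [inner_formOp]
    -- The gradient of u₀, the solution for b = 0, represents f. The residual w is orthogonal to all
    -- real gradients, hence to their closed complex span.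
    set w := NormedSpace.exp (mulOp (volume.restrict D) (EuclideanSpace ℂ (Fin d)) (toC b))
      (cgrad D u) - cgrad D u₀ with hw
    have hgen : ∀ v : H10 D, inner ℂ w (cgrad D v) = 0 := by
      intro v
      have h1 := inner_exp_mulOp_cgrad b u v
      have h2 := inner_exp_mulOp_cgrad 0 u₀ v
      rw [map_zero, map_zero, NormedSpace.exp_zero, one_apply_eq_self] at h2
      rw [hw, inner_sub_left, h1, h2, h v, h₀ v, sub_self]
    have horth : w ∈ (gradSpace D)ᗮ := by
      rw [gradSpace, Submodule.orthogonal_closure, Submodule.mem_orthogonal']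
      intro z hz
      induction hz using Submodule.span_induction with
      | mem x hx =>
        obtain ⟨v, rfl⟩ := hx
        exact hgen v
      | zero => exact inner_zero_right _
      | add x y _ _ hx hy => rw [inner_add_right, hx, hy, add_zero]
      | smul a x _ hx => rw [inner_smul_right, hx, mul_zero]
    have h3 := (Submodule.mem_orthogonal' _ _).1 horth k k.2
    rw [hw, inner_sub_left, sub_eq_zero] at h3
    exact h3
  exact congrArg Subtype.val (eq_solveOp (gradSpace D) (imL_toC_lt b) hform)

/-! ### The Gaussian log-coefficient -/

/-- Completing the square gives c|t| ≤ t²/8 + 2c², which leaves exp(-t²/8) after multiplication by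
the Gaussian density. -/
lemma integrable_exp_sq_add_abs (c : ℝ) :
    Integrable (fun t : ℝ => Real.exp (t ^ 2 / 4 + c * |t|)) (gaussianReal 0 1) := by
  rw [← integrable_pdf_smul_iff]
  have h := (integrable_exp_neg_mul_sq (b := 1 / 8) (by norm_num)).const_mul
    ((√(2 * Real.pi))⁻¹ * Real.exp (2 * c ^ 2))
  refine h.mono' ?_ (ae_of_all _ fun t => ?_)
  · refine Continuous.aestronglyMeasurable ?_
    simp only [gaussianPDFReal_def, smul_eq_mul]
    fun_prop
  · rw [norm_smul, Real.norm_of_nonneg (gaussianPDFReal_nonneg _ _ _),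
      Real.norm_of_nonneg (Real.exp_pos _).le, gaussianPDFReal_def]
    simp only [NNReal.coe_one, mul_one, sub_zero]
    rw [mul_assoc, mul_assoc, ← Real.exp_add, ← Real.exp_add]
    refine mul_le_mul_of_nonneg_left (Real.exp_le_exp.2 ?_) (by positivity)
    nlinarith [sq_nonneg (|t| - 4 * c), sq_abs t]

lemma lintegral_eval_gaussian (j : ℕ) {g : ℝ → ℝ≥0∞} (hg : Measurable g) :
    ∫⁻ y, g (y j) ∂gaussian = ∫⁻ t, g t ∂(gaussianReal 0 1) :=
  (measurePreserving_eval_infinitePi (fun _ : ℕ => gaussianReal 0 1) j).lintegral_comp hg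

/-- The summands tend to 0, so λ_j ≥ 1 from some index on; finitely many terms remain. -/
lemma exists_bound_inv {lam : ℕ → ℝ} (hpos : ∀ j, 0 < lam j)
    (hsum : Summable fun j => Real.exp (-(lam j) ^ 2)) : ∃ A : ℝ, 0 ≤ A ∧ ∀ j, (lam j)⁻¹ ≤ A := by
  have hlim := hsum.tendsto_atTop_zero
  have hev : ∀ᶠ j in atTop, Real.exp (-(lam j) ^ 2) < Real.exp (-1) :=
    hlim.eventually_lt_const (Real.exp_pos _)
  obtain ⟨N, hN⟩ := eventually_atTop.1 hev
  have hnn : 0 ≤ ∑ j ∈ Finset.range N, (lam j)⁻¹ :=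
    Finset.sum_nonneg fun j _ => (inv_pos.2 (hpos j)).le
  refine ⟨1 + ∑ j ∈ Finset.range N, (lam j)⁻¹, by positivity, fun j => ?_⟩
  by_cases hj : N ≤ j
  · have h1 := Real.exp_lt_exp.1 (hN j hj)
    have h2 : 1 ≤ lam j := by nlinarith [hpos j]
    have := inv_le_one_of_one_le₀ h2
    linarith
  · have := Finset.single_le_sum (f := fun j => (lam j)⁻¹)
      (fun j _ => (inv_pos.2 (hpos j)).le) (Finset.mem_range.2 (not_le.1 hj))
    linarith

/-- A random variable with finite expectation which bounds `exp (k |y_j| / λ_j)` for all `j`. -/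
lemma exists_exp_majorant {lam : ℕ → ℝ} (hpos : ∀ j, 0 < lam j)
    (hsum : Summable fun j => Real.exp (-(lam j) ^ 2)) {k : ℝ} (hk : 0 ≤ k) :
    ∃ Z : (ℕ → ℝ) → ℝ≥0∞, ∫⁻ y, Z y ∂gaussian ≠ ⊤ ∧ Measurable Z ∧
      ∀ y j, ENNReal.ofReal (Real.exp (k * |y j| / lam j)) ≤ Z y := by
  obtain ⟨A, hA0, hA⟩ := exists_bound_inv hpos hsum
  -- Below the cut |t| = 2λ_j the exponent is at most 2k. Above it t²/4 > λ_j², so the factor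
  -- exp(-λ_j²) can be inserted at the cost of exp(t²/4), which makes the expectations summable over
  -- j.
  set g : ℕ → ℝ → ℝ≥0∞ := fun j => Set.indicator {t : ℝ | 2 * lam j < |t|}
    fun t => ENNReal.ofReal (Real.exp (k * |t| / lam j)) with hg
  have hgm : ∀ j, Measurable (g j) := fun j =>
    Measurable.indicator (by fun_prop) (measurableSet_lt measurable_const (by fun_prop))
  have hgle : ∀ j t, g j t ≤ ENNReal.ofReal (Real.exp (-(lam j) ^ 2)) *
      ENNReal.ofReal (Real.exp (t ^ 2 / 4 + k * A * |t|)) := by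
    intro j t
    simp only [hg]
    by_cases ht : t ∈ {t : ℝ | 2 * lam j < |t|}
    · rw [Set.indicator_of_mem ht, ← ENNReal.ofReal_mul (Real.exp_pos _).le, ← Real.exp_add]
      refine ENNReal.ofReal_le_ofReal (Real.exp_le_exp.2 ?_)
      have h1 : k * |t| / lam j ≤ k * A * |t| := by
        rw [div_eq_mul_inv]
        have := mul_le_mul_of_nonneg_left (hA j) (mul_nonneg hk (abs_nonneg t))
        linarith
      have h2 : 2 * lam j < |t| := ht
      nlinarith [hpos j, sq_abs t]
    · rw [Set.indicator_of_notMem ht]; exact zero_le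
  refine ⟨fun y => ENNReal.ofReal (Real.exp (2 * k)) + ∑' j, g j (y j), ?_, ?_, fun y j => ?_⟩
  · rw [lintegral_add_left measurable_const, lintegral_const, measure_univ, mul_one,
      lintegral_tsum (f := fun j (y : ℕ → ℝ) => g j (y j))
        fun j => ((hgm j).comp (measurable_pi_apply j)).aemeasurable]
    refine ENNReal.add_ne_top.2 ⟨ENNReal.ofReal_ne_top, ?_⟩
    set I := ∫⁻ t, ENNReal.ofReal (Real.exp (t ^ 2 / 4 + k * A * |t|)) ∂(gaussianReal 0 1)
    have hI : I ≠ ⊤ := (integrable_exp_sq_add_abs (k * A)).lintegral_lt_top.ne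
    refine ne_top_of_le_ne_top (b := ∑' j, ENNReal.ofReal (Real.exp (-(lam j) ^ 2)) * I) ?_ ?_
    · rw [ENNReal.tsum_mul_right]
      exact ENNReal.mul_ne_top hsum.tsum_ofReal_ne_top hI
    · refine ENNReal.tsum_le_tsum fun j => ?_
      rw [lintegral_eval_gaussian j (hgm j), ← lintegral_const_mul _ (by fun_prop)]
      exact lintegral_mono fun t => hgle j t
  · exact measurable_const.add
      (Measurable.tsum fun j => (hgm j).comp (measurable_pi_apply j))
  · by_cases ht : 2 * lam j < |y j|
    · refine le_trans (le_of_eq ?_) ((ENNReal.le_tsum j).trans le_add_self)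
      simp only [hg]
      rw [Set.indicator_of_mem (show y j ∈ {t : ℝ | 2 * lam j < |t|} from ht)]
    · refine le_trans (ENNReal.ofReal_le_ofReal (Real.exp_le_exp.2 ?_)) le_self_add
      rw [div_le_iff₀ (hpos j)]
      push Not at ht
      nlinarith

section LogCoeff

variable {d : ℕ} {D : Set (Space d)} {ψ : ℕ → LInf D}

lemma IsLogCoeff.unique {y : ℕ → ℝ} {b b' : LInf D} (h : IsLogCoeff ψ y b)
    (h' : IsLogCoeff ψ y b') : b = b' := by
  refine Lp.ext ?_
  filter_upwards [h, h'] with x hx hx'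
  exact tendsto_nhds_unique hx hx'

/-- Partial sums beyond j change by one fixed term. Hence U₀ contains whole coordinate lines and b
is affine along them. -/
lemma IsLogCoeff.update {y : ℕ → ℝ} {b : LInf D} (h : IsLogCoeff ψ y b) (j : ℕ) (t : ℝ) :
    IsLogCoeff ψ (Function.update y j t) (b + (t - y j) • ψ j) := by
  unfold IsLogCoeff at h ⊢
  filter_upwards [h, Lp.coeFn_add b ((t - y j) • ψ j), Lp.coeFn_smul (t - y j) (ψ j)]
    with x hx h1 h2
  rw [h1, Pi.add_apply, h2, Pi.smul_apply, smul_eq_mul]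
  refine (hx.add_const ((t - y j) * ψ j x)).congr' ?_
  filter_upwards [eventually_gt_atTop j] with n hn
  have hj : j ∈ Finset.range n := Finset.mem_range.2 hn
  rw [← Finset.add_sum_erase _ _ hj, ← Finset.add_sum_erase _ (fun i =>
    Function.update y j t i * ψ i x) hj, Function.update_self]
  have : ∑ i ∈ (Finset.range n).erase j, Function.update y j t i * ψ i x =
      ∑ i ∈ (Finset.range n).erase j, y i * ψ i x :=
    Finset.sum_congr rfl fun i hi => by
      rw [Function.update_of_ne (Finset.ne_of_mem_erase hi)]
  rw [this]
  ring

open Classical in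
/-- The coefficient `b(y)`, with the value `0` outside of `U₀`. -/
def logCoeff (ψ : ℕ → LInf D) (y : ℕ → ℝ) : LInf D :=
  if h : ∃ b : LInf D, IsLogCoeff ψ y b then h.choose else 0

lemma logCoeff_eq {y : ℕ → ℝ} {b : LInf D} (h : IsLogCoeff ψ y b) : logCoeff ψ y = b := by
  have hex : ∃ b : LInf D, IsLogCoeff ψ y b := ⟨b, h⟩
  rw [logCoeff, dif_pos hex]
  exact hex.choose_spec.unique h

lemma coeFn_sum_smul (c : ℕ → ℝ) (g : ℕ → LInf D) (s : Finset ℕ) :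
    (∑ j ∈ s, c j • g j : LInf D) =ᵐ[volume.restrict D] fun x => ∑ j ∈ s, c j * g j x := by
  classical
  induction s using Finset.induction_on with
  | empty =>
    filter_upwards [Lp.coeFn_zero ℝ ⊤ (volume.restrict D)] with x hx
    simp only [Finset.sum_empty]
    exact hx
  | insert j s hj ih =>
    rw [Finset.sum_insert hj]
    filter_upwards [ih, Lp.coeFn_add (c j • g j) (∑ j ∈ s, c j • g j),
      Lp.coeFn_smul (c j) (g j)] with x h1 h2 h3
    rw [h2, Pi.add_apply, h1, h3, Finset.sum_insert hj, Pi.smul_apply, smul_eq_mul]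

lemma norm_sum_smul_le {lam y : ℕ → ℝ} {M : ℝ} (hM : ∀ j, |y j| ≤ M * lam j)
    (hM0 : 0 ≤ M) (s : Finset ℕ) :
    ‖∑ j ∈ s, y j • ψ j‖ ≤ M * ‖∑ j ∈ s, lam j • |ψ j|‖ := by
  refine Lp.norm_le_of_ae (by positivity) ?_
  have habs : ∀ᵐ x ∂(volume.restrict D), ∀ j, (|ψ j| : LInf D) x = |ψ j x| :=
    ae_all_iff.2 fun j => Lp.coeFn_abs (ψ j)
  filter_upwards [coeFn_sum_smul y ψ s, coeFn_sum_smul lam (fun j => |ψ j|) s, habs,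
    Lp.ae_norm_le (∑ j ∈ s, lam j • |ψ j|)] with x h1 h2 h3 h4
  rw [h1]
  refine le_trans ?_ (mul_le_mul_of_nonneg_left ((le_abs_self _).trans h4) hM0)
  rw [h2, Finset.mul_sum]
  refine (norm_sum_le _ _).trans (Finset.sum_le_sum fun j _ => ?_)
  rw [norm_mul, h3, Real.norm_eq_abs, Real.norm_eq_abs, ← mul_assoc]
  exact mul_le_mul_of_nonneg_right (hM j) (abs_nonneg _)

/-- If `|y_j| ≤ M λ_j`, the series `∑_j y_j ψ_j` converges in `L^∞(D)`. -/
lemma exists_logCoeff {lam y : ℕ → ℝ} {M : ℝ} (hM : ∀ j, |y j| ≤ M * lam j) (hM0 : 0 ≤ M)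
    {S : LInf D} (hS : Tendsto (fun n => ∑ j ∈ Finset.range n, lam j • |ψ j|) atTop (𝓝 S)) :
    ∃ b : LInf D, IsLogCoeff ψ y b ∧ ‖b‖ ≤ M * ‖S‖ ∧
      Tendsto (fun n => ∑ j ∈ Finset.range n, y j • ψ j) atTop (𝓝 b) := by
  have hcauchy : CauchySeq fun n => ∑ j ∈ Finset.range n, y j • ψ j := by
    rw [Metric.cauchySeq_iff']
    intro ε hε
    obtain ⟨N, hN⟩ := Metric.cauchySeq_iff'.1 hS.cauchySeq (ε / (M + 1)) (by positivity)
    refine ⟨N, fun n hn => ?_⟩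
    have h1 := hN n hn
    rw [dist_eq_norm, ← Finset.sum_Ico_eq_sub _ hn] at h1 ⊢
    calc _ ≤ M * ‖∑ j ∈ Finset.Ico N n, lam j • |ψ j|‖ := norm_sum_smul_le hM hM0 _
      _ ≤ (M + 1) * ‖∑ j ∈ Finset.Ico N n, lam j • |ψ j|‖ :=
        mul_le_mul_of_nonneg_right (by linarith) (norm_nonneg _)
      _ < (M + 1) * (ε / (M + 1)) := mul_lt_mul_of_pos_left h1 (by positivity)
      _ = ε := by field_simp
  obtain ⟨b, hb⟩ := cauchySeq_tendsto_of_complete hcauchy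
  refine ⟨b, ?_, ?_, hb⟩
  · have hae : ∀ᵐ x ∂(volume.restrict D), ∀ n,
        ‖∑ j ∈ Finset.range n, y j * ψ j x - b x‖ ≤ ‖∑ j ∈ Finset.range n, y j • ψ j - b‖ := by
      refine ae_all_iff.2 fun n => ?_
      filter_upwards [coeFn_sum_smul y ψ (Finset.range n),
        Lp.coeFn_sub (∑ j ∈ Finset.range n, y j • ψ j) b,
        Lp.ae_norm_le (∑ j ∈ Finset.range n, y j • ψ j - b)] with x h1 h2 h3
      rw [h2, Pi.sub_apply, h1] at h3
      exact h3
    unfold IsLogCoeff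
    filter_upwards [hae] with x hx
    exact tendsto_iff_norm_sub_tendsto_zero.2
      (squeeze_zero (fun _ => norm_nonneg _) hx (tendsto_iff_norm_sub_tendsto_zero.1 hb))
  · exact le_of_tendsto_of_tendsto' hb.norm (hS.norm.const_mul M)
      fun n => norm_sum_smul_le hM hM0 _

/-- Under the standing assumption, `b(y)` exists almost surely and has exponential moments. -/
lemma isGaussianCoeff_logCoeff (hψ : SeriesAssumption ψ) :
    (∀ᵐ y ∂gaussian, y ∈ U0 ψ) ∧ IsGaussianCoeff ψ (logCoeff ψ) := by
  obtain ⟨lam, hpos, hsum, S, hS⟩ := hψ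
  -- With M = log Z / k, this choice gives 2‖b‖ ≤ 2M‖S‖ ≤ log Z, that is exp(‖b‖)² ≤ Z; the +1 keeps
  -- k positive when S = 0.
  set k : ℝ := 2 * ‖S‖ + 1 with hk
  have hk0 : 0 < k := by positivity
  obtain ⟨Z, hZint, hZm, hZ⟩ := exists_exp_majorant hpos hsum hk0.le
  have hZfin : ∀ᵐ y ∂gaussian, Z y < ⊤ := ae_lt_top hZm hZint
  have hmain : ∀ y, Z y < ⊤ → ∃ b : LInf D, IsLogCoeff ψ y b ∧
      Real.exp ‖b‖ ^ 2 ≤ (Z y).toReal ∧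
      Tendsto (fun n => ∑ j ∈ Finset.range n, y j • ψ j) atTop (𝓝 b) := by
    intro y hy
    have hz : ∀ j, Real.exp (k * |y j| / lam j) ≤ (Z y).toReal := fun j => by
      have := hZ y j
      rwa [ENNReal.ofReal_le_iff_le_toReal hy.ne] at this
    have hz1 : 1 ≤ (Z y).toReal := by
      refine le_trans ?_ (hz 0)
      rw [← Real.exp_zero]
      exact Real.exp_le_exp.2 (div_nonneg (by positivity) (hpos 0).le)
    have hlog : 0 ≤ Real.log (Z y).toReal := Real.log_nonneg hz1
    have hM : ∀ j, |y j| ≤ Real.log (Z y).toReal / k * lam j := fun j => by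
      have h1 := (Real.le_log_iff_exp_le (by linarith)).2 (hz j)
      rw [div_le_iff₀ (hpos j)] at h1
      rw [div_mul_eq_mul_div, le_div_iff₀ hk0]
      linarith
    obtain ⟨b, h1, h2, h3⟩ := exists_logCoeff hM (by positivity) hS
    refine ⟨b, h1, ?_, h3⟩
    rw [← Real.exp_nat_mul, ← Real.le_log_iff_exp_le (by linarith)]
    refine (mul_le_mul_of_nonneg_left h2 (by norm_num)).trans ?_
    rw [div_mul_eq_mul_div, mul_div_assoc', div_le_iff₀ hk0]
    push_cast
    nlinarith
  have hmeas : AEStronglyMeasurable (logCoeff ψ) gaussian := by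
    refine aestronglyMeasurable_of_tendsto_ae atTop
      (f := fun n y => ∑ j ∈ Finset.range n, y j • ψ j) (fun n => ?_) ?_
    · refine Continuous.aestronglyMeasurable ?_
      exact continuous_finsetSum _ fun j _ => (continuous_apply j).smul continuous_const
    · filter_upwards [hZfin] with y hy
      obtain ⟨b, hb, -, hlim⟩ := hmain y hy
      rwa [logCoeff_eq hb]
  refine ⟨?_, hmeas, ⟨?_, ?_⟩, ?_⟩
  · filter_upwards [hZfin] with y hy
    obtain ⟨b, hb, -⟩ := hmain y hy
    exact ⟨b, hb⟩
  · exact (Real.continuous_exp.comp_aestronglyMeasurable hmeas.norm).pow 2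
  · refine (lintegral_mono_ae ?_).trans_lt (lt_top_iff_ne_top.2 hZint)
    filter_upwards [hZfin] with y hy
    obtain ⟨b, hb, hle, -⟩ := hmain y hy
    rw [logCoeff_eq hb, Real.enorm_eq_ofReal (by positivity)]
    exact (ENNReal.ofReal_le_iff_le_toReal hy.ne).2 hle
  · filter_upwards [hZfin] with y hy j t
    obtain ⟨b, hb, -⟩ := hmain y hy
    rw [logCoeff_eq hb, logCoeff_eq (hb.update j t)]

end LogCoeff

/-! ### The parametric solution -/

lemma map_hermiteCoeff {X Y : Type*} [NormedAddCommGroup X] [NormedSpace ℝ X] [CompleteSpace X]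
    [NormedAddCommGroup Y] [NormedSpace ℝ Y] [CompleteSpace Y] (L : X →L[ℝ] Y)
    {w : (ℕ → ℝ) → X} (hw : MemLp w 2 gaussian) (ν : ℕ →₀ ℕ) :
    L (hermiteCoeff w ν) = hermiteCoeff (fun y => L (w y)) ν := by
  unfold hermiteCoeff
  rw [← L.integral_comp_comm (integrable_hermiteMulti_smul hw ν)]
  simp only [map_smul]

lemma norm_hermiteCoeff_coe {Y : Type*} [NormedAddCommGroup Y] [InnerProductSpace ℂ Y]
    [CompleteSpace Y] (K : Submodule ℂ Y) [CompleteSpace K] {w : (ℕ → ℝ) → K}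
    (hw : MemLp w 2 gaussian) (ν : ℕ →₀ ℕ) :
    ‖hermiteCoeff (fun y => (w y : Y)) ν‖ = ‖hermiteCoeff w ν‖ :=
  (congrArg norm (map_hermiteCoeff (K.subtypeL.restrictScalars ℝ) hw ν)).symm

lemma hermiteCoeff_congr {X : Type*} [NormedAddCommGroup X] [NormedSpace ℝ X]
    {w w' : (ℕ → ℝ) → X} (h : w =ᵐ[gaussian] w') (ν : ℕ →₀ ℕ) :
    hermiteCoeff w ν = hermiteCoeff w' ν :=
  integral_congr_ae (h.mono fun y hy => by simp only [hy])

section Solution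

variable {d : ℕ} {D : Set (Space d)} {ψ : ℕ → LInf D} {f : H10 D →L[ℝ] ℝ}

lemma isWeakSolution_iff_eq_solution (hd : 1 ≤ d) (hDb : Bornology.IsBounded D) {y : ℕ → ℝ}
    {b : LInf D} (hb : IsLogCoeff ψ y b) (w : H10 D) :
    IsWeakSolution b f w ↔ w = solution ψ f y := by
  obtain ⟨u, hu, huniq⟩ := existsUnique_isWeakSolution hd hDb b f
  have hex : ∃ u : H10 D, ∃ b : LInf D, IsLogCoeff ψ y b ∧ IsWeakSolution b f u := ⟨u, b, hb, hu⟩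
  have hsol : IsWeakSolution b f (solution ψ f y) := by
    rw [solution, dif_pos hex]
    obtain ⟨b', hb', hw'⟩ := hex.choose_spec
    rwa [hb'.unique hb] at hw'
  constructor
  · intro hw
    exact (huniq w hw).trans (huniq _ hsol).symm
  · rintro rfl
    exact hsol

lemma ae_cgrad_solution (hd : 1 ≤ d) (hDb : Bornology.IsBounded D) (hψ : SeriesAssumption ψ)
    {u₀ : H10 D} (h₀ : IsWeakSolution 0 f u₀) :
    ∀ᵐ y ∂gaussian, cgrad D (solution ψ f y) =
      (solveOp (gradSpace D) ⟨cgrad D u₀, cgrad_mem u₀⟩ (toC (logCoeff ψ y)) :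
        Lp (EuclideanSpace ℂ (Fin d)) 2 (volume.restrict D)) := by
  filter_upwards [(isGaussianCoeff_logCoeff hψ).1] with y hy
  obtain ⟨b, hb⟩ := hy
  rw [logCoeff_eq hb]
  exact cgrad_eq_solveOp h₀ ((isWeakSolution_iff_eq_solution hd hDb hb _).2 rfl)

/-- By Poincaré the complex gradient is bounded below, hence an embedding, through which both
measurability and integrability are pulled back. -/
lemma memLp_solution (hd : 1 ≤ d) (hDb : Bornology.IsBounded D) (hψ : SeriesAssumption ψ) :
    MemLp (solution ψ f) 2 gaussian := by
  obtain ⟨u₀, h₀, -⟩ := existsUnique_isWeakSolution hd hDb 0 f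
  obtain ⟨C, hC0, hC⟩ := exists_norm_le_normV hd hDb
  have hC' : ∀ v : H10 D, ‖v‖ ≤ C * ‖cgrad D v‖ := fun v => by
    rw [norm_cgrad]; exact hC v
  have hg := (isGaussianCoeff_logCoeff hψ).2.memLp (isStripHolomorphic_solveOp (gradSpace D)
    ⟨cgrad D u₀, cgrad_mem u₀⟩)
  have hae := ae_cgrad_solution hd hDb hψ h₀
  have hL : MemLp (fun y => cgrad D (solution ψ f y)) 2 gaussian := by
    refine (hg.norm.congr_norm ?_ ?_)
    · exact ((gradSpace D).subtypeL.continuous.comp_aestronglyMeasurable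
        hg.aestronglyMeasurable).congr (hae.mono fun y hy => hy.symm)
    · filter_upwards [hae] with y hy
      rw [hy, norm_norm]; rfl
  have hemb : IsEmbedding (cgrad D) :=
    ((cgrad D).antilipschitz_of_bound (K := ⟨C, hC0.le⟩) hC').isEmbedding (cgrad D).continuous
  exact hL.of_le_mul (hemb.aestronglyMeasurable_comp_iff.1 hL.aestronglyMeasurable)
    (ae_of_all _ fun y => hC' _)

lemma normV_hermiteCoeff (hd : 1 ≤ d) (hDb : Bornology.IsBounded D) (hψ : SeriesAssumption ψ)
    {u₀ : H10 D} (h₀ : IsWeakSolution 0 f u₀) (ν : ℕ →₀ ℕ) :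
    normV (hermiteCoeff (solution ψ f) ν) =
      ‖hermiteCoeff (fun y => solveOp (gradSpace D) ⟨cgrad D u₀, cgrad_mem u₀⟩
        (toC (logCoeff ψ y))) ν‖ := by
  have hg := (isGaussianCoeff_logCoeff hψ).2.memLp (isStripHolomorphic_solveOp (gradSpace D)
    ⟨cgrad D u₀, cgrad_mem u₀⟩)
  rw [← norm_cgrad, map_hermiteCoeff (cgrad D) (memLp_solution hd hDb hψ) ν,
    hermiteCoeff_congr (ae_cgrad_solution hd hDb hψ h₀) ν]
  exact norm_hermiteCoeff_coe (gradSpace D) hg ν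

/-- The maximum appears because `ENNReal.ofReal` truncates a negative κ to 0. -/
lemma ae_sum_le_of_essSup_le {R : ℕ → ℝ} (hR : ∀ j, 0 ≤ R j) {κ : ℝ}
    (h : essSup (fun x => ∑' j, ENNReal.ofReal (R j * |ψ j x|)) (volume.restrict D) ≤
      ENNReal.ofReal κ) :
    ∀ᵐ x ∂(volume.restrict D), ∀ n, ∑ j ∈ Finset.range n, R j * |ψ j x| ≤ max κ 0 := by
  filter_upwards [ENNReal.ae_le_essSup (μ := volume.restrict D)
    (fun x => ∑' j, ENNReal.ofReal (R j * |ψ j x|))] with x hx n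
  have h1 := ((ENNReal.sum_le_tsum (Finset.range n)).trans hx).trans h
  rw [← ENNReal.ofReal_sum_of_nonneg fun j _ => mul_nonneg (hR j) (abs_nonneg _)] at h1
  rw [← ENNReal.ofReal_le_ofReal_iff (le_max_right κ 0)]
  exact h1.trans (ENNReal.ofReal_le_ofReal (le_max_left _ _))

lemma summable_beta_normV (hd : 1 ≤ d) (hDb : Bornology.IsBounded D) (hψ : SeriesAssumption ψ)
    {ϱ : ℕ → ℝ} (hϱ : ∀ j, 0 < ϱ j) {r : ℕ} {ρ : (ℕ →₀ ℕ) → ℕ → ℝ} (hρ : ∀ ν j, 0 ≤ ρ ν j)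
    (hsupp : ∀ (ν : ℕ →₀ ℕ) (j : ℕ), ν j ≠ 0 → ρ ν j ≠ 0) {κ : ℝ} (hκ : κ < Real.pi / 2)
    (hρκ : ∀ ν, essSup (fun x => ∑' j, ENNReal.ofReal (ρ ν j * |ψ j x|)) (volume.restrict D)
      ≤ ENNReal.ofReal κ)
    (hsum : Summable fun ν : {ν : ℕ →₀ ℕ // ∀ j, ν j ≤ r} =>
      multiFactorial ν.1 * multiPow ϱ (2 • ν.1) / multiPow (ρ ν.1) (2 • ν.1)) :
    Summable fun ν : ℕ →₀ ℕ =>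
      beta r ϱ ν * normV (hermiteCoeff (solution ψ f) ν) ^ 2 := by
  obtain ⟨u₀, h₀, -⟩ := existsUnique_isWeakSolution hd hDb 0 f
  have hb := (isGaussianCoeff_logCoeff hψ).2
  have hG := isStripHolomorphic_solveOp (gradSpace D) ⟨cgrad D u₀, cgrad_mem u₀⟩
  have hκ' : max κ 0 < Real.pi / 2 := max_lt hκ (by positivity)
  obtain ⟨C, hC0, hC⟩ := hG.growth _ hκ'
  simp only [normV_hermiteCoeff hd hDb hψ h₀]
  set Q := (C * Real.exp (max κ 0)) ^ 2 * ∫ y, Real.exp ‖logCoeff ψ y‖ ^ 2 ∂gaussian with hQ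
  have hQ0 : 0 ≤ Q := mul_nonneg (sq_nonneg _) (integral_nonneg fun y => by positivity)
  -- Each μ uses its own polydisc, with radii ρ_μ, while Q is common to all of them.
  refine summable_beta_mul hϱ
    (B := fun μ => multiFactorial μ / multiPow (ρ μ) (2 • μ) * Q) (fun μ => ?_)
    (fun ν => sq_nonneg _) (fun μ T => ?_) ?_
  · refine mul_nonneg (div_nonneg (Finset.prod_nonneg fun j _ => by positivity)
      (Finset.prod_nonneg fun j _ => pow_nonneg (hρ μ j) _)) hQ0
  · exact hb.sum_multiChoose_le hG (le_max_right κ 0) hκ' hC0 hC μ (hρ μ) (hsupp μ)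
      (ae_sum_le_of_essSup_le (hρ μ) (hρκ μ)) T
  · refine (hsum.mul_right Q).congr fun μ => ?_
    ring

end Solution

end LogGaussian

end

theorem theorem3p16 {d : ℕ} (hd : 1 ≤ d) (D : Set (LogGaussian.Space d))
    (hD : IsOpen D) (hDb : Bornology.IsBounded D)
    (f : LogGaussian.H10 D →L[ℝ] ℝ)
    (ψ : ℕ → LogGaussian.LInf D) (hψ : LogGaussian.SeriesAssumption ψ)
    (q : ℝ) (hq : 0 < q)
    (ϱ : ℕ → ℝ) (hϱ : ∀ j, 0 < ϱ j) (hϱq : Memℓp (fun j => (ϱ j)⁻¹) (ENNReal.ofReal q))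
    (r : ℕ) (hr : 2 / q < (r : ℝ))
    (ρ : (ℕ →₀ ℕ) → ℕ → ℝ) (hρ : ∀ ν j, 0 ≤ ρ ν j)
    (hsupp : ∀ (ν : ℕ →₀ ℕ) (j : ℕ), ν j ≠ 0 → ρ ν j ≠ 0)
    (κ : ℝ) (hκ : κ < Real.pi / 2)
    (hρκ : ∀ ν, essSup (fun x => ∑' j, ENNReal.ofReal (ρ ν j * |ψ j x|)) (volume.restrict D)
      ≤ ENNReal.ofReal κ)
    (hsum : Summable fun ν : {ν : ℕ →₀ ℕ // ∀ j, ν j ≤ r} =>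
      LogGaussian.multiFactorial ν.1 * LogGaussian.multiPow ϱ (2 • ν.1)
        / LogGaussian.multiPow (ρ ν.1) (2 • ν.1)) :
    -- the problem is well posed for almost every parameter, and `u` lies in `L²(U, V; γ)`
    (∀ᵐ y ∂LogGaussian.gaussian, y ∈ LogGaussian.U0 ψ) ∧
    (∀ y b, LogGaussian.IsLogCoeff ψ y b → ∀ w : LogGaussian.H10 D,
      LogGaussian.IsWeakSolution b f w ↔ w = LogGaussian.solution ψ f y) ∧
    MemLp (LogGaussian.solution ψ f) 2 LogGaussian.gaussian ∧
    -- weighted square summability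
    (Summable fun ν : ℕ →₀ ℕ => LogGaussian.beta r ϱ ν *
      LogGaussian.normV (LogGaussian.hermiteCoeff (LogGaussian.solution ψ f) ν) ^ 2) ∧
    Memℓp (fun ν : ℕ →₀ ℕ => LogGaussian.beta r ϱ ν ^ (-(1 / 2) : ℝ)) (ENNReal.ofReal q) ∧
    -- summability of the coefficients
    ∀ p : ℝ, 1 / p = 1 / q + 1 / 2 →
      Memℓp (fun ν : ℕ →₀ ℕ =>
        LogGaussian.normV (LogGaussian.hermiteCoeff (LogGaussian.solution ψ f) ν))
        (ENNReal.ofReal p) := by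

  have hbeta := LogGaussian.summable_beta_normV (f := f) hd hDb hψ hϱ hρ hsupp hκ hρκ hsum
  have hell := LogGaussian.memℓp_beta hq hϱ hϱq hr
  exact ⟨(LogGaussian.isGaussianCoeff_logCoeff hψ).1,
    fun y b hb w => LogGaussian.isWeakSolution_iff_eq_solution hd hDb hb w,
    LogGaussian.memLp_solution hd hDb hψ, hbeta, hell,
    fun p hp => LogGaussian.memℓp_of_weighted hq hp (LogGaussian.beta_pos r ϱ)
      (fun ν => norm_nonneg _) hbeta hell⟩
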